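/- Let $a>0$ and let $\Omega\subset\mathbb R^2$ be the open triangle with vertices $p,q,r$, where $|pq|=|pr|=a$ and the angle at $p$ is $\pi/2$ (an isosceles right triangle with legs $a$ and area $a^2/2$). For $\lambda\in\mathbb R$ let $E^D_\lambda$ be the space of all real $u\in H^2(\Omega)\cap H^1_0(\Omega)$ with $\Delta u+\lambda u=0$ in $\Omega$, and let $E^N_\lambda$ be the space of all real $u\in H^2(\Omega)$ with $\Delta u+\lambda u=0$ in $\Omega$ whose normal derivative vanishes on $\partial\Omega$, that is, $\int_\Omega\nabla u\cdot\nabla v+\int_\Omega(\Delta u)\,v=0$ for all $v\in H^1(\Omega)$. For $t>0$ let $$H^D(t)=\sum_{\lambda}\dim(E^D_\lambda)\,e^{-\lambda t},\qquad H^N(t)=\sum_{\lambda}\dim(E^N_\lambda)\,e^{-\lambda t}$$ be the heat traces with the Dirichlet and the Neumann boundary condition, that is, the sums of $e^{-\lambda t}$ over all eigenvalues $\lambda$, counted with multiplicity. Then $H^D(t)$ and $H^N(t)$ are finite for every $t>0$, and as $t\to0^+$ $$H^D(t)=\frac{a^2}{8\pi t}-\frac{a(2+\sqrt2)}{8\sqrt{\pi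 t}}+\frac38-\frac{a}{2\sqrt{2\pi t}}\,e^{-\frac{a^2}{2t}}+\frac{a^2}{2\pi t}\,e^{-\frac{a^2}{t}}+R^D(t),$$ $$H^N(t)=\frac{a^2}{8\pi t}+\frac{a(2+\sqrt2)}{8\sqrt{\pi t}}+\frac38+\frac{a}{2\sqrt{2\pi t}}\,e^{-\frac{a^2}{2t}}+\frac{a^2}{2\pi t}\,e^{-\frac{a^2}{t}}+R^N(t),$$ where $R^D(t)$ and $R^N(t)$ are both $O\big(t^{-1/2}e^{-a^2/t}\big)$. These remainder estimates are sharp: conversely $t^{-1/2}e^{-a^2/t}=O(|R^D(t)|)$ and $t^{-1/2}e^{-a^2/t}=O(|R^N(t)|)$ as $t\to0^+$. -/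

import Mathlib

open MeasureTheory Filter Asymptotics
open scoped Topology ENNReal ContDiff Distributions

noncomputable section

namespace DomainHeat

/-- The Euclidean plane. -/
abbrev Plane : Type := EuclideanSpace ℝ (Fin 2)

/-- The real Hilbert space `L²(Ω)`, for Lebesgue measure on the open set `Ω`. -/
abbrev L2 (Ω : TopologicalSpace.Opens Plane) : Type :=
  Lp ℝ 2 ((volume : Measure Plane).restrict (Ω : Set Plane))

variable {Ω : TopologicalSpace.Opens Plane}

/-- The classical partial derivative `∂ᵢ f` of a function on the plane. -/
def partialDeriv (i : Fin 2) (f : Plane → ℝ) (x : Plane) : ℝ :=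
  fderiv ℝ f x (EuclideanSpace.single i 1)

/-- `g ∈ L²(Ω)` is the weak partial derivative `∂ᵢ u` of `u ∈ L²(Ω)`:
`∫_Ω u ∂ᵢφ = - ∫_Ω g φ` for all test functions `φ ∈ C_c^∞(Ω)`. -/
def IsWeakPartial (i : Fin 2) (u g : L2 Ω) : Prop :=
  ∀ φ : 𝓓(Ω, ℝ), ∫ x in (Ω : Set Plane), u x * partialDeriv i φ x
    = - ∫ x in (Ω : Set Plane), g x * φ x

theorem partialDeriv_add (i : Fin 2) (φ ψ : 𝓓(Ω, ℝ)) :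
    partialDeriv i (φ + ψ : 𝓓(Ω, ℝ)) = partialDeriv i φ + partialDeriv i ψ := by
  funext x
  have h1 : DifferentiableAt ℝ φ x := φ.contDiff.differentiable (by simp) x
  have h2 : DifferentiableAt ℝ ψ x := ψ.contDiff.differentiable (by simp) x
  have h : ((φ + ψ : 𝓓(Ω, ℝ)) : Plane → ℝ) = (φ : Plane → ℝ) + ψ := rfl
  simp [partialDeriv, h, fderiv_add h1 h2]

theorem partialDeriv_smul (i : Fin 2) (c : ℝ) (φ : 𝓓(Ω, ℝ)) :
    partialDeriv i (c • φ : 𝓓(Ω, ℝ)) = c • partialDeriv i φ := by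
  funext x
  have h1 : DifferentiableAt ℝ φ x := φ.contDiff.differentiable (by simp) x
  have h : ((c • φ : 𝓓(Ω, ℝ)) : Plane → ℝ) = c • (φ : Plane → ℝ) := rfl
  simp [partialDeriv, h, fderiv_const_smul h1 c]

theorem memLp_testFunction (φ : 𝓓(Ω, ℝ)) :
    MemLp φ 2 ((volume : Measure Plane).restrict (Ω : Set Plane)) :=
  (φ.continuous.memLp_of_hasCompactSupport φ.hasCompactSupport).restrict _

theorem memLp_partialDeriv (i : Fin 2) (φ : 𝓓(Ω, ℝ)) :
    MemLp (partialDeriv i φ) 2 ((volume : Measure Plane).restrict (Ω : Set Plane)) := by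
  have hc : Continuous (partialDeriv i φ) :=
    (φ.contDiff.continuous_fderiv (by simp)).clm_apply continuous_const
  have hs : HasCompactSupport (partialDeriv i φ) :=
    φ.hasCompactSupport.fderiv_apply (𝕜 := ℝ) _
  exact (hc.memLp_of_hasCompactSupport hs).restrict _

theorem integral_add_mul (u v : L2 Ω) {f : Plane → ℝ}
    (hf : MemLp f 2 ((volume : Measure Plane).restrict (Ω : Set Plane))) :
    ∫ x in (Ω : Set Plane), (u + v : L2 Ω) x * f x
      = (∫ x in (Ω : Set Plane), u x * f x) + ∫ x in (Ω : Set Plane), v x * f x := by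
  have hu : Integrable (fun x => u x * f x) _ := (Lp.memLp u).integrable_mul hf
  have hv : Integrable (fun x => v x * f x) _ := (Lp.memLp v).integrable_mul hf
  rw [← integral_add hu hv]
  refine integral_congr_ae ?_
  filter_upwards [Lp.coeFn_add u v] with x hx
  simp only [hx, Pi.add_apply, add_mul]

theorem integral_smul_mul (c : ℝ) (u : L2 Ω) (f : Plane → ℝ) :
    ∫ x in (Ω : Set Plane), (c • u : L2 Ω) x * f x
      = c * ∫ x in (Ω : Set Plane), u x * f x := by
  rw [← integral_const_mul]
  refine integral_congr_ae ?_
  filter_upwards [Lp.coeFn_smul c u] with x hx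
  simp only [hx, Pi.smul_apply, smul_eq_mul, mul_assoc]

theorem IsWeakPartial.add {i : Fin 2} {u v g k : L2 Ω} (hu : IsWeakPartial i u g)
    (hv : IsWeakPartial i v k) : IsWeakPartial i (u + v) (g + k) := fun φ => by
  rw [integral_add_mul _ _ (memLp_partialDeriv i φ), integral_add_mul _ _ (memLp_testFunction φ),
    hu φ, hv φ]
  ring

theorem IsWeakPartial.smul {i : Fin 2} {u g : L2 Ω} (c : ℝ) (hu : IsWeakPartial i u g) :
    IsWeakPartial i (c • u) (c • g) := fun φ => by
  rw [integral_smul_mul, integral_smul_mul, hu φ]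
  ring

theorem IsWeakPartial.zero (i : Fin 2) : IsWeakPartial i (0 : L2 Ω) 0 := by
  intro φ
  have h := integral_smul_mul (Ω := Ω) 0 0 (partialDeriv i φ)
  have h' := integral_smul_mul (Ω := Ω) 0 0 φ
  simp only [smul_zero, zero_mul] at h h'
  rw [h, h', neg_zero]

/-- `u ∈ H¹(Ω)` with weak gradient `g = (∂₁u, ∂₂u)`. -/
def IsH1 (u : L2 Ω) (g : Fin 2 → L2 Ω) : Prop :=
  ∀ i, IsWeakPartial i u (g i)

/-- `u ∈ H²(Ω)` with weak gradient `g` and weak second derivatives `h i j = ∂ⱼ∂ᵢu`. -/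
def IsH2 (u : L2 Ω) (g : Fin 2 → L2 Ω) (h : Fin 2 → Fin 2 → L2 Ω) : Prop :=
  IsH1 u g ∧ ∀ i, IsH1 (g i) (h i)

variable (Ω) in
/-- The pairs `(φ, ∇φ)` with `φ ∈ C_c^∞(Ω)`, as elements of `L²(Ω) × L²(Ω)²`. -/
def testGraph : Submodule ℝ (L2 Ω × (Fin 2 → L2 Ω)) where
  carrier := {p | ∃ φ : 𝓓(Ω, ℝ),
    p.1 =ᵐ[(volume : Measure Plane).restrict (Ω : Set Plane)] φ ∧
    ∀ i, p.2 i =ᵐ[(volume : Measure Plane).restrict (Ω : Set Plane)] partialDeriv i φ}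
  add_mem' := by
    rintro p q ⟨φ, h0, h1⟩ ⟨ψ, k0, k1⟩
    refine ⟨φ + ψ, (Lp.coeFn_add _ _).trans (h0.add k0), fun i => ?_⟩
    rw [partialDeriv_add]
    exact (Lp.coeFn_add _ _).trans ((h1 i).add (k1 i))
  zero_mem' := by
    refine ⟨0, Lp.coeFn_zero _ _ _, fun i => ?_⟩
    have h : partialDeriv i ((0 : 𝓓(Ω, ℝ)) : Plane → ℝ) = 0 := by
      have := partialDeriv_smul i (0 : ℝ) (0 : 𝓓(Ω, ℝ))
      simpa only [smul_zero, zero_smul] using this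
    rw [h]
    exact Lp.coeFn_zero _ _ _
  smul_mem' := by
    rintro c p ⟨φ, h0, h1⟩
    refine ⟨c • φ, (Lp.coeFn_smul _ _).trans (h0.const_smul c), fun i => ?_⟩
    rw [partialDeriv_smul]
    exact (Lp.coeFn_smul _ _).trans ((h1 i).const_smul c)

variable (Ω) in
/-- The pairs `(u, ∇u)` with `u ∈ H¹₀(Ω)`, the closure of `C_c^∞(Ω)` in `H¹(Ω)`. -/
def sobolevZeroGraph : Submodule ℝ (L2 Ω × (Fin 2 → L2 Ω)) :=
  (testGraph Ω).topologicalClosure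

/-- The Neumann condition for `u ∈ H²(Ω)` with weak gradient `g` and weak second derivatives `h`:
the normal derivative of `u` on `∂Ω` vanishes, in the sense that the boundary term in Green's
formula is zero, `∫_Ω ∇u · ∇v + ∫_Ω (Δu) v = 0` for all `v ∈ H¹(Ω)`. -/
def NormalDerivVanishes (g : Fin 2 → L2 Ω) (h : Fin 2 → Fin 2 → L2 Ω) : Prop :=
  ∀ (v : L2 Ω) (k : Fin 2 → L2 Ω), IsH1 v k →
    (∑ i, inner ℝ (g i) (k i)) + inner ℝ (∑ i, h i i) v = 0

variable (Ω) in
/-- The Dirichlet eigenspace for `lam`: all `u ∈ H²(Ω) ∩ H¹₀(Ω)` with `Δu + lam u = 0` in `Ω`. -/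
def dirichletEigenspace (lam : ℝ) : Submodule ℝ (L2 Ω) where
  carrier := {u | ∃ g h, IsH2 u g h ∧ (u, g) ∈ sobolevZeroGraph Ω ∧ (∑ i, h i i) + lam • u = 0}
  add_mem' := by
    rintro u v ⟨g, h, ⟨h1, h2⟩, hz, he⟩ ⟨g', h', ⟨h1', h2'⟩, hz', he'⟩
    refine ⟨g + g', h + h', ⟨fun i => (h1 i).add (h1' i), fun i j => (h2 i j).add (h2' i j)⟩,
      (sobolevZeroGraph Ω).add_mem hz hz', ?_⟩
    have := congrArg₂ (· + ·) he he'
    simp only [Pi.add_apply, Finset.sum_add_distrib, smul_add, add_zero] at this ⊢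
    rw [← this]; abel
  zero_mem' := ⟨0, 0, ⟨fun i => .zero i, fun _ j => .zero j⟩, (sobolevZeroGraph Ω).zero_mem,
    by simp⟩
  smul_mem' := by
    rintro c u ⟨g, h, ⟨h1, h2⟩, hz, he⟩
    refine ⟨c • g, c • h, ⟨fun i => (h1 i).smul c, fun i j => (h2 i j).smul c⟩,
      (sobolevZeroGraph Ω).smul_mem c hz, ?_⟩
    have := congrArg (c • ·) he
    simpa only [Pi.smul_apply, ← Finset.smul_sum, smul_add, smul_zero, smul_comm lam c] using this

variable (Ω) in
/-- The Neumann eigenspace for `lam`: all `u ∈ H²(Ω)` with vanishing normal derivative on `∂Ω`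
and `Δu + lam u = 0` in `Ω`. -/
def neumannEigenspace (lam : ℝ) : Submodule ℝ (L2 Ω) where
  carrier := {u | ∃ g h, IsH2 u g h ∧ NormalDerivVanishes g h ∧ (∑ i, h i i) + lam • u = 0}
  add_mem' := by
    rintro u v ⟨g, h, ⟨h1, h2⟩, hz, he⟩ ⟨g', h', ⟨h1', h2'⟩, hz', he'⟩
    refine ⟨g + g', h + h', ⟨fun i => (h1 i).add (h1' i), fun i j => (h2 i j).add (h2' i j)⟩,
      fun w k hw => ?_, ?_⟩
    · have := congrArg₂ (· + ·) (hz w k hw) (hz' w k hw)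
      simp only [Pi.add_apply, Finset.sum_add_distrib, inner_add_left, add_zero] at this ⊢
      rw [← this]; abel
    · have := congrArg₂ (· + ·) he he'
      simp only [Pi.add_apply, Finset.sum_add_distrib, smul_add, add_zero] at this ⊢
      rw [← this]; abel
  zero_mem' := ⟨0, 0, ⟨fun i => .zero i, fun _ j => .zero j⟩, fun _ _ _ => by simp, by simp⟩
  smul_mem' := by
    rintro c u ⟨g, h, ⟨h1, h2⟩, hz, he⟩
    refine ⟨c • g, c • h, ⟨fun i => (h1 i).smul c, fun i j => (h2 i j).smul c⟩,
      fun w k hw => ?_, ?_⟩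
    · have := congrArg (c * ·) (hz w k hw)
      simpa only [Pi.smul_apply, ← Finset.smul_sum, real_inner_smul_left, ← Finset.mul_sum,
        ← mul_add, mul_zero] using this
    · have := congrArg (c • ·) he
      simpa only [Pi.smul_apply, ← Finset.smul_sum, smul_add, smul_zero, smul_comm lam c] using this

/-- The sum of `exp (-lam t)` over all eigenvalues `lam`, each counted with the dimension of its
eigenspace `V lam` (a real `lam` that is not an eigenvalue has `V lam = 0` and contributes `0`),
as an element of `[0, ∞]`: no convergence and no finite multiplicity is presupposed. -/
def heatTraceOf (V : ℝ → Submodule ℝ (L2 Ω)) (t : ℝ) : ℝ≥0∞ :=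
  ∑' lam : ℝ, ((Module.rank ℝ (V lam)).toENat : ℝ≥0∞) * ENNReal.ofReal (Real.exp (-lam * t))

variable (Ω) in
/-- The heat trace of `Ω` with the Dirichlet boundary condition. -/
def dirichletHeatTrace (t : ℝ) : ℝ≥0∞ := heatTraceOf (dirichletEigenspace Ω) t

variable (Ω) in
/-- The heat trace of `Ω` with the Neumann boundary condition. -/
def neumannHeatTrace (t : ℝ) : ℝ≥0∞ := heatTraceOf (neumannEigenspace Ω) t

/-- The open triangle with vertices `p`, `q`, `r`. -/
def openTriangle (p q r : Plane) : TopologicalSpace.Opens Plane :=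
  ⟨interior (convexHull ℝ {p, q, r}), isOpen_interior⟩

end DomainHeat

end

/-!
The spectrum of the right isosceles triangle is explicit. In an orthonormal frame with origin `q`
and axes along `p - q` and `r - p` the triangle is `0 < Y < X < a`, half of a square, and the
Dirichlet and Neumann eigenfunctions are the products `sin(mπX/a) sin(nπY/a)`, antisymmetrised, and
`cos(mπX/a) cos(nπY/a)`, symmetrised, with eigenvalue `(π/a)² (m² + n²)`; here `m > n ≥ 1` and
`m ≥ n ≥ 0` respectively. Hence `H^D = (S² - S₂) / 2` and `H^N = ((1 + S)² + (1 + S₂)) / 2` with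
`S = ∑_{n ≥ 1} exp (-(π/a)² n² t)` and `S₂` the same sum at `2t`. Poisson summation
(`one_add_two_mul_gaussSum`) turns these into the stated expansion, and the dominant omitted term is
`∓ a / (2 √(π t)) exp (-a² / t)` (`trace_sub_expansion`, `tendsto_scaledRemainder`), which gives the
two-sided estimate of the remainder.

That these functions account for the whole spectrum, with `H²`, `H¹₀` and the Neumann condition
understood weakly, rests on the following points.

* Eigenspaces for different eigenvalues are orthogonal, directly from the weak formulations
  (`dirichletEigenspace_inner_eq_zero`, `neumannEigenspace_inner_eq_zero`).
* A smooth function vanishing on the boundary is in `H¹₀`, and Green's formula holds for every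
  `v ∈ H¹` and every smooth vector field tangential to the boundary. Both are proved by multiplying
  with a product of cutoffs in the distances to the sides: the gradient of the cutoff blows up like
  the inverse distance, but only meets a factor that vanishes on that side, so dominated convergence
  applies (`toL2_mem_sobolevZeroGraph`, `integral_grad_add_integral_div_eq_zero`). No trace theorem
  and no density of smooth functions in `H¹` is used.
* The functions are orthogonal: the integral over the triangle is half of that over the square
  (`inner_pairL2`).
* They are complete. The symmetrised products of cosines span an algebra that separates the points
  of the closed triangle, so the Stone–Weierstrass theorem applies; the antisymmetrised products of
  sines contain the multiples of this algebra by the nowhere vanishing function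
  `sin(2πX/a) sin(πY/a) - sin(πX/a) sin(2πY/a)` (`eq_zero_of_forall_symCos`,
  `eq_zero_of_forall_skewSin`).

A complete orthogonal family of this kind determines the dimensions of all eigenspaces
(`rank_eq_card_fiber`).
-/

noncomputable section

namespace DomainHeat

/-! ### One-dimensional theta sums -/

/-- The one-sided theta sum `∑_{n ≥ 1} exp (-c n²)`. -/
def gaussSum (c : ℝ) : ℝ := ∑' n : ℕ, Real.exp (-c * ((n : ℝ) + 1) ^ 2)

theorem summable_gaussSum {c : ℝ} (hc : 0 < c) :
    Summable fun n : ℕ => Real.exp (-c * ((n : ℝ) + 1) ^ 2) := by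
  have hg : Summable fun n : ℕ => Real.exp (-c) ^ n :=
    summable_geometric_of_lt_one (Real.exp_pos _).le (by simpa using hc)
  refine Summable.of_nonneg_of_le (fun n => (Real.exp_pos _).le) (fun n => ?_) hg
  rw [← Real.exp_nat_mul]
  refine Real.exp_le_exp.2 ?_
  have hn : (0 : ℝ) ≤ n := n.cast_nonneg
  nlinarith [mul_nonneg hc.le hn, mul_nonneg hc.le (mul_nonneg hn hn)]

theorem gaussSum_nonneg (c : ℝ) : 0 ≤ gaussSum c := tsum_nonneg fun _ => (Real.exp_pos _).le

theorem tsum_int_exp_neg_mul_sq {c : ℝ} (hc : 0 < c) :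
    ∑' n : ℤ, Real.exp (-c * (n : ℝ) ^ 2) = 1 + 2 * gaussSum c := by
  have h := (summable_gaussSum hc).hasSum
  have h1 : HasSum (fun n : ℕ => Real.exp (-c * (((n : ℤ) + 1 : ℤ) : ℝ) ^ 2)) (gaussSum c) := by
    simpa [gaussSum] using h
  have h2 : HasSum (fun n : ℕ => Real.exp (-c * ((-((n : ℤ) + 1) : ℤ) : ℝ) ^ 2)) (gaussSum c) := by
    convert h1 using 4
    push_cast
    ring
  have := HasSum.of_add_one_of_neg_add_one
    (f := fun n : ℤ => Real.exp (-c * (n : ℝ) ^ 2)) h1 h2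
  rw [this.tsum_eq]
  simp
  ring

/-- Poisson summation for the theta sum. -/
theorem one_add_two_mul_gaussSum {c : ℝ} (hc : 0 < c) :
    1 + 2 * gaussSum c = √(Real.pi / c) * (1 + 2 * gaussSum (Real.pi ^ 2 / c)) := by
  have hpi := Real.pi_pos
  have h := Real.tsum_exp_neg_mul_int_sq (a := c / Real.pi) (by positivity)
  rw [← tsum_int_exp_neg_mul_sq hc, ← tsum_int_exp_neg_mul_sq (c := Real.pi ^ 2 / c) (by positivity)]
  convert h using 2
  · ext n
    congr 2
    field_simp
  · rw [← Real.sqrt_eq_rpow, one_div, ← Real.sqrt_inv, inv_div]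
  · congr 1
    ext n
    congr 2
    field_simp

/-- The theta sum without its first term. -/
def gaussTail (c : ℝ) : ℝ := gaussSum c - Real.exp (-c)

theorem gaussTail_eq {c : ℝ} (hc : 0 < c) :
    gaussTail c = ∑' n : ℕ, Real.exp (-c * ((n : ℝ) + 2) ^ 2) := by
  rw [gaussTail, gaussSum, (summable_gaussSum hc).tsum_eq_zero_add]
  simp only [Nat.cast_zero, zero_add, one_pow, mul_one, add_sub_cancel_left, Nat.cast_add,
    Nat.cast_one, add_assoc]
  norm_num

theorem gaussTail_nonneg {c : ℝ} (hc : 0 < c) : 0 ≤ gaussTail c := by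
  rw [gaussTail_eq hc]
  exact tsum_nonneg fun _ => (Real.exp_pos _).le

/-- A geometric series majorises the tail, since `(n + 2)² ≥ n + 4`. -/
theorem gaussTail_le {c : ℝ} (hc : 1 ≤ c) : gaussTail c ≤ 2 * Real.exp (-4 * c) := by
  have hc0 : 0 < c := by linarith
  have he : Real.exp (-c) ≤ 1 / 2 := by
    have h2 : (2 : ℝ) ≤ Real.exp c := by have := Real.add_one_le_exp c; linarith
    rw [Real.exp_neg, one_div]
    exact inv_anti₀ (by norm_num) h2
  have hlt : Real.exp (-c) < 1 := by linarith
  have hg := (hasSum_geometric_of_lt_one (Real.exp_pos (-c)).le hlt).mul_left (Real.exp (-4 * c))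
  have hle : ∀ n : ℕ, Real.exp (-c * ((n : ℝ) + 2) ^ 2)
      ≤ Real.exp (-4 * c) * Real.exp (-c) ^ n := fun n => by
    rw [← Real.exp_nat_mul, ← Real.exp_add]
    refine Real.exp_le_exp.2 ?_
    have hn : (0 : ℝ) ≤ n := n.cast_nonneg
    nlinarith [mul_nonneg hc0.le hn, mul_nonneg hc0.le (mul_nonneg hn hn)]
  rw [gaussTail_eq hc0]
  refine (Summable.tsum_le_tsum hle (Summable.of_nonneg_of_le (fun n => (Real.exp_pos _).le) hle
    hg.summable) hg.summable).trans ?_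
  rw [hg.tsum_eq, mul_comm]
  refine mul_le_mul_of_nonneg_right ?_ (Real.exp_pos _).le
  rw [inv_le_comm₀ (by linarith) (by norm_num)]
  linarith

/-! ### The remainder -/

/-- The remainder in the expansion of the heat traces, as a function of `s = a² / t`, after the
factor `t ^ (-1/2) * exp (-s)` has been taken out; `σ` is the sign of the boundary terms. -/
def scaledRemainder (a σ s : ℝ) : ℝ :=
  a / (2 * Real.pi) * (√s * (Real.exp s * (gaussTail s + gaussSum s ^ 2)))
    + σ * (a / (2 * √Real.pi) * (Real.exp s * gaussSum s)
      + a / (2 * √(2 * Real.pi)) * (Real.exp s * gaussTail (s / 2)))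

theorem tendsto_exp_neg_nhds : Tendsto (fun s : ℝ => Real.exp (-s)) atTop (𝓝 0) :=
  Real.tendsto_exp_atBot.comp tendsto_neg_atTop_atBot

theorem tendsto_exp_mul_gaussTail :
    Tendsto (fun s : ℝ => Real.exp s * gaussTail s) atTop (𝓝 0) := by
  have h : Tendsto (fun s : ℝ => 2 * Real.exp (-s)) atTop (𝓝 0) := by
    simpa using tendsto_exp_neg_nhds.const_mul 2
  refine tendsto_of_tendsto_of_tendsto_of_le_of_le' tendsto_const_nhds h ?_ ?_
  · filter_upwards [eventually_ge_atTop 1] with s hs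
    exact mul_nonneg (Real.exp_pos _).le (gaussTail_nonneg (by linarith))
  · filter_upwards [eventually_ge_atTop 1] with s hs
    calc Real.exp s * gaussTail s ≤ Real.exp s * (2 * Real.exp (-4 * s)) :=
          mul_le_mul_of_nonneg_left (gaussTail_le hs) (Real.exp_pos _).le
      _ = 2 * Real.exp (-3 * s) := by
          rw [mul_left_comm, ← Real.exp_add]; congr 2; ring
      _ ≤ 2 * Real.exp (-s) := by gcongr; linarith

theorem tendsto_exp_mul_gaussTail_half :
    Tendsto (fun s : ℝ => Real.exp s * gaussTail (s / 2)) atTop (𝓝 0) := by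
  have h : Tendsto (fun s : ℝ => 2 * Real.exp (-s)) atTop (𝓝 0) := by
    simpa using tendsto_exp_neg_nhds.const_mul 2
  refine tendsto_of_tendsto_of_tendsto_of_le_of_le' tendsto_const_nhds h ?_ ?_
  · filter_upwards [eventually_ge_atTop 1] with s hs
    exact mul_nonneg (Real.exp_pos _).le (gaussTail_nonneg (by linarith))
  · filter_upwards [eventually_ge_atTop 2] with s hs
    calc Real.exp s * gaussTail (s / 2) ≤ Real.exp s * (2 * Real.exp (-4 * (s / 2))) :=
          mul_le_mul_of_nonneg_left (gaussTail_le (by linarith)) (Real.exp_pos _).le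
      _ = 2 * Real.exp (-s) := by
          rw [mul_left_comm, ← Real.exp_add]; congr 2; ring

theorem tendsto_exp_mul_gaussSum :
    Tendsto (fun s : ℝ => Real.exp s * gaussSum s) atTop (𝓝 1) := by
  have h : (fun s : ℝ => Real.exp s * gaussSum s) = fun s => 1 + Real.exp s * gaussTail s := by
    ext s
    rw [gaussTail, mul_sub, ← Real.exp_add]
    simp
  rw [h]
  simpa using tendsto_exp_mul_gaussTail.const_add 1

theorem tendsto_sqrt_mul_exp_mul_quadratic :
    Tendsto (fun s : ℝ => √s * (Real.exp s * (gaussTail s + gaussSum s ^ 2))) atTop (𝓝 0) := by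
  have h : Tendsto (fun s : ℝ => 11 * (s ^ (1 / 2 : ℝ) * Real.exp (-1 * s))) atTop (𝓝 0) := by
    simpa using (tendsto_rpow_mul_exp_neg_mul_atTop_nhds_zero (1 / 2) 1 one_pos).const_mul 11
  refine tendsto_of_tendsto_of_tendsto_of_le_of_le' tendsto_const_nhds h ?_ ?_
  · filter_upwards [eventually_ge_atTop 1] with s hs
    have := gaussTail_nonneg (c := s) (by linarith)
    positivity
  · filter_upwards [eventually_ge_atTop 1] with s hs
    have h1 : gaussTail s ≤ 2 * Real.exp (-4 * s) := gaussTail_le hs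
    have h2 : Real.exp (-4 * s) ≤ Real.exp (-2 * s) := Real.exp_le_exp.2 (by linarith)
    have h3 : Real.exp (-4 * s) ≤ Real.exp (-s) := Real.exp_le_exp.2 (by linarith)
    have h4 : gaussSum s ≤ 3 * Real.exp (-s) := by
      have : gaussSum s = Real.exp (-s) + gaussTail s := by rw [gaussTail]; ring
      linarith
    have h5 : Real.exp (-s) ^ 2 = Real.exp (-2 * s) := by
      rw [← Real.exp_nat_mul]; congr 1; push_cast; ring
    have h6 : gaussSum s ^ 2 ≤ 9 * Real.exp (-2 * s) := by
      rw [← h5]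
      calc gaussSum s ^ 2 ≤ (3 * Real.exp (-s)) ^ 2 :=
            pow_le_pow_left₀ (gaussSum_nonneg s) h4 2
        _ = 9 * Real.exp (-s) ^ 2 := by ring
    have h7 : gaussTail s + gaussSum s ^ 2 ≤ 11 * Real.exp (-2 * s) := by linarith
    rw [← Real.sqrt_eq_rpow]
    calc √s * (Real.exp s * (gaussTail s + gaussSum s ^ 2))
        ≤ √s * (Real.exp s * (11 * Real.exp (-2 * s))) := by gcongr
      _ = 11 * (√s * (Real.exp s * Real.exp (-2 * s))) := by ring
      _ = 11 * (√s * Real.exp (-1 * s)) := by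
          rw [← Real.exp_add]; congr 3; ring

theorem tendsto_scaledRemainder (a σ : ℝ) :
    Tendsto (scaledRemainder a σ) atTop (𝓝 (σ * (a / (2 * √Real.pi)))) := by
  have h := (tendsto_sqrt_mul_exp_mul_quadratic.const_mul (a / (2 * Real.pi))).add
    (((tendsto_exp_mul_gaussSum.const_mul (a / (2 * √Real.pi))).add
      (tendsto_exp_mul_gaussTail_half.const_mul (a / (2 * √(2 * Real.pi))))).const_mul σ)
  rw [mul_zero, mul_zero, mul_one, add_zero, zero_add] at h
  exact h

/-- The trace `θ(t)² / 8 + σ θ(t) / 4 + σ θ(2t) / 4 + 3 / 8`, where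
`θ(t) = 1 + 2 * gaussSum ((π / a)² t)`, minus the expansion is the scaled remainder times
`t ^ (-1/2) * exp (-a² / t)`. After Poisson summation this is an algebraic identity. -/
theorem trace_sub_expansion {a t : ℝ} (ha : 0 < a) (ht : 0 < t) (σ : ℝ) :
    ((1 + 2 * gaussSum ((Real.pi / a) ^ 2 * t)) ^ 2 / 8
        + σ * ((1 + 2 * gaussSum ((Real.pi / a) ^ 2 * t)) / 4)
        + σ * ((1 + 2 * gaussSum ((Real.pi / a) ^ 2 * (2 * t))) / 4) + 3 / 8) -
      (a ^ 2 / (8 * Real.pi * t) + σ * (a * (2 + √2) / (8 * √(Real.pi * t))) + 3 / 8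
          + σ * (a / (2 * √(2 * Real.pi * t)) * Real.exp (-a ^ 2 / (2 * t)))
          + a ^ 2 / (2 * Real.pi * t) * Real.exp (-a ^ 2 / t))
      = scaledRemainder a σ (a ^ 2 / t) * (t ^ (-(1 / 2) : ℝ) * Real.exp (-a ^ 2 / t)) := by
  have hpi := Real.pi_pos
  have e1 : Real.pi ^ 2 / ((Real.pi / a) ^ 2 * t) = a ^ 2 / t := by field_simp
  have e2 : Real.pi ^ 2 / ((Real.pi / a) ^ 2 * (2 * t)) = a ^ 2 / t / 2 := by field_simp
  have e3 : √(Real.pi / ((Real.pi / a) ^ 2 * t)) = a / (√Real.pi * √t) := by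
    rw [show Real.pi / ((Real.pi / a) ^ 2 * t) = a ^ 2 / (Real.pi * t) by field_simp,
      Real.sqrt_div (by positivity), Real.sqrt_sq ha.le, Real.sqrt_mul hpi.le]
  have e4 : √(Real.pi / ((Real.pi / a) ^ 2 * (2 * t))) = a / (√2 * √Real.pi * √t) := by
    rw [show Real.pi / ((Real.pi / a) ^ 2 * (2 * t)) = a ^ 2 / (2 * Real.pi * t) by field_simp,
      Real.sqrt_div (by positivity), Real.sqrt_sq ha.le, Real.sqrt_mul (by positivity),
      Real.sqrt_mul (by positivity)]
  rw [one_add_two_mul_gaussSum (c := (Real.pi / a) ^ 2 * t) (by positivity),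
    one_add_two_mul_gaussSum (c := (Real.pi / a) ^ 2 * (2 * t)) (by positivity), e1, e2, e3, e4,
    scaledRemainder, Real.rpow_neg ht.le, ← Real.sqrt_eq_rpow, Real.sqrt_mul hpi.le,
    Real.sqrt_mul (by positivity), Real.sqrt_mul (by positivity),
    Real.sqrt_div (by positivity), Real.sqrt_sq ha.le]
  have e5 : -a ^ 2 / t = -(a ^ 2 / t) := by ring
  have e6 : -a ^ 2 / (2 * t) = -(a ^ 2 / t / 2) := by ring
  rw [e5, e6]
  set s := a ^ 2 / t
  have hP : gaussSum s = gaussTail s + Real.exp (-s) := by rw [gaussTail]; ring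
  have hQ : gaussSum (s / 2) = gaussTail (s / 2) + Real.exp (-(s / 2)) := by rw [gaussTail]; ring
  have hE : Real.exp (-s) = (Real.exp s)⁻¹ := Real.exp_neg s
  rw [hQ]
  have hT : gaussTail s = gaussSum s - Real.exp (-s) := by rw [gaussTail]
  rw [hT, hE]
  have hes := (Real.exp_pos s).ne'
  have st : √t ^ 2 = t := Real.sq_sqrt ht.le
  have sp : √Real.pi ^ 2 = Real.pi := Real.sq_sqrt hpi.le
  have s2 : √(2 : ℝ) ^ 2 = 2 := Real.sq_sqrt (by norm_num)
  have ht0 : √t ≠ 0 := (Real.sqrt_pos.2 ht).ne'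
  have hp0 : √Real.pi ≠ 0 := (Real.sqrt_pos.2 hpi).ne'
  have h20 : √(2 : ℝ) ≠ 0 := (Real.sqrt_pos.2 (by norm_num)).ne'
  -- only the squares of the roots matter from here on
  generalize √t = rt at *
  generalize √Real.pi = rp at *
  generalize √(2 : ℝ) = r2 at *
  generalize Real.exp s = es at *
  rw [← sp, ← st]
  have h2inv : 1 / r2 = r2 / 2 := by field_simp; linarith
  field_simp
  ring_nf
  simp only [s2]
  ring

theorem isTheta_of_eq_scaledRemainder {a σ : ℝ} (ha : 0 < a) (hσ : σ ≠ 0) {R : ℝ → ℝ}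
    (hR : ∀ t, 0 < t → R t
      = scaledRemainder a σ (a ^ 2 / t) * (t ^ (-(1 / 2) : ℝ) * Real.exp (-a ^ 2 / t))) :
    R =Θ[𝓝[>] 0] (fun t : ℝ => t ^ (-(1 / 2) : ℝ) * Real.exp (-a ^ 2 / t)) := by
  have hs : Tendsto (fun t : ℝ => a ^ 2 / t) (𝓝[>] 0) atTop := by
    simpa [div_eq_mul_inv] using
      tendsto_inv_nhdsGT_zero.const_mul_atTop (show (0 : ℝ) < a ^ 2 by positivity)
  have hlim := (tendsto_scaledRemainder a σ).comp hs
  have hc : σ * (a / (2 * √Real.pi)) ≠ 0 := mul_ne_zero hσ (by positivity)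
  refine (isTheta_of_div_tendsto_nhds_ne_zero (c := σ * (a / (2 * √Real.pi))) ?_ hc).symm
  refine hlim.congr' ?_
  filter_upwards [self_mem_nhdsWithin] with t ht
  have ht' : (0 : ℝ) < t := ht
  have : t ^ (-(1 / 2) : ℝ) * Real.exp (-a ^ 2 / t) ≠ 0 := by positivity
  rw [hR t ht', Function.comp_apply, mul_div_assoc, div_self this, mul_one]

variable {Ω : TopologicalSpace.Opens Plane}

/-! ### Heat traces from complete orthogonal families of eigenfunctions -/

/-- A complete orthogonal family `e` with `e i ∈ V (ν i)`, such that `V lam` is orthogonal to `e i`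
whenever `ν i ≠ lam`, determines `V`: the dimension of `V lam` is the number of `i` with
`ν i = lam`. -/
theorem rank_eq_card_fiber {H ι : Type*} [NormedAddCommGroup H] [InnerProductSpace ℝ H]
    {V : ℝ → Submodule ℝ H} {e : ι → H} {ν : ι → ℝ} (he : ∀ i, e i ∈ V (ν i))
    (hne : ∀ i, e i ≠ 0) (horth : Pairwise fun i j => inner ℝ (e i) (e j) = 0)
    (hcross : ∀ lam, ∀ u ∈ V lam, ∀ i, ν i ≠ lam → inner ℝ (e i) u = 0)
    (hcomp : ∀ u, (∀ i, inner ℝ (e i) u = 0) → u = 0) (lam : ℝ)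
    [Finite {i // ν i = lam}] :
    (Module.rank ℝ (V lam)).toENat = ENat.card {i // ν i = lam} := by
  let w : {i // ν i = lam} → H := fun i => e i
  have hw : LinearIndependent ℝ w :=
    linearIndependent_of_ne_zero_of_inner_eq_zero (fun i => hne i)
      fun i j hij => horth fun h => hij (Subtype.ext h)
  have hspan : V lam = Submodule.span ℝ (Set.range w) := by
    have hle : Submodule.span ℝ (Set.range w) ≤ V lam := by
      rw [Submodule.span_le]
      rintro _ ⟨⟨i, rfl⟩, rfl⟩
      exact he i
    refine le_antisymm (fun u hu => ?_) hle
    have : FiniteDimensional ℝ (Submodule.span ℝ (Set.range w)) :=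
      FiniteDimensional.span_of_finite ℝ (Set.finite_range w)
    set S := Submodule.span ℝ (Set.range w)
    have hmem : u - S.starProjection u ∈ V lam :=
      (V lam).sub_mem hu (hle (S.starProjection_apply_mem u))
    have hzero : u - S.starProjection u = 0 := by
      refine hcomp _ fun i => ?_
      by_cases hi : ν i = lam
      · have h1 : e i ∈ S := Submodule.subset_span ⟨⟨i, hi⟩, rfl⟩
        exact (Submodule.mem_orthogonal _ _).1 (S.sub_starProjection_mem_orthogonal u) _ h1
      · exact hcross lam _ hmem i hi
    rw [sub_eq_zero.1 hzero]
    exact S.starProjection_apply_mem u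
  rw [hspan, rank_span hw]
  exact (ENat.card_congr (Equiv.ofInjective w hw.injective)).symm

theorem heatTraceOf_eq_tsum {ι : Type*}
    {V : ℝ → Submodule ℝ (L2 Ω)} {e : ι → L2 Ω} {ν : ι → ℝ} (he : ∀ i, e i ∈ V (ν i))
    (hne : ∀ i, e i ≠ 0) (horth : Pairwise fun i j => inner ℝ (e i) (e j) = 0)
    (hcross : ∀ lam, ∀ u ∈ V lam, ∀ i, ν i ≠ lam → inner ℝ (e i) u = 0)
    (hcomp : ∀ u, (∀ i, inner ℝ (e i) u = 0) → u = 0)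
    (hfin : ∀ lam, Finite {i // ν i = lam}) (t : ℝ) :
    heatTraceOf V t = ∑' i, ENNReal.ofReal (Real.exp (-ν i * t)) := by
  rw [heatTraceOf, ← (Equiv.sigmaFiberEquiv ν).tsum_eq, ENNReal.tsum_sigma']
  congr 1
  ext lam
  have := hfin lam
  rw [rank_eq_card_fiber he hne horth hcross hcomp lam]
  have : ∀ i : {i // ν i = lam}, ENNReal.ofReal (Real.exp (-ν (Equiv.sigmaFiberEquiv ν ⟨lam, i⟩) * t))
      = ENNReal.ofReal (Real.exp (-lam * t)) := by
    rintro ⟨i, rfl⟩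
    rfl
  simp_rw [this]
  rw [ENNReal.tsum_const]

/-! ### Sums over ordered pairs -/

theorem tsum_diagonal (g : ℕ → ℝ≥0∞) :
    ∑' p : ℕ × ℕ, (if p.1 = p.2 then g p.1 * g p.2 else 0) = ∑' n, g n ^ 2 := by
  rw [ENNReal.tsum_prod']
  congr 1
  ext n
  simp only [eq_comm (a := n)]
  rw [tsum_ite_eq n fun m => g n * g m, sq]

theorem tsum_sq_eq_two_mul_tsum_lt_add (g : ℕ → ℝ≥0∞) :
    (∑' n, g n) ^ 2
      = 2 * (∑' p : {p : ℕ × ℕ // p.2 < p.1}, g p.1.1 * g p.1.2) + ∑' n, g n ^ 2 := by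
  have h1 : (∑' n, g n) ^ 2 = ∑' p : ℕ × ℕ, g p.1 * g p.2 := by
    rw [ENNReal.tsum_prod', sq, ← ENNReal.tsum_mul_right]
    simp_rw [ENNReal.tsum_mul_left]
  have hlt : ∑' p : {p : ℕ × ℕ // p.2 < p.1}, g p.1.1 * g p.1.2
      = ∑' p : ℕ × ℕ, if p.2 < p.1 then g p.1 * g p.2 else 0 := by
    refine (tsum_subtype {p : ℕ × ℕ | p.2 < p.1} fun p => g p.1 * g p.2).trans
      (tsum_congr fun p => ?_)
    simp [Set.indicator]
  have hgt : ∑' p : ℕ × ℕ, (if p.1 < p.2 then g p.1 * g p.2 else 0)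
      = ∑' p : ℕ × ℕ, if p.2 < p.1 then g p.1 * g p.2 else 0 := by
    rw [← (Equiv.prodComm ℕ ℕ).tsum_eq]
    simp only [Equiv.prodComm_apply, Prod.fst_swap, Prod.snd_swap]
    simp_rw [mul_comm]
  have heq := tsum_diagonal g
  rw [h1, hlt, two_mul]
  nth_rw 2 [← hgt]
  rw [← heq, ← ENNReal.tsum_add, ← ENNReal.tsum_add]
  congr 1
  ext ⟨m, n⟩
  rcases lt_trichotomy m n with h | h | h
  · simp [h, h.not_gt, h.ne]
  · simp [h]
  · simp [h, h.not_gt, h.ne']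

theorem tsum_le_eq_tsum_lt_add (g : ℕ → ℝ≥0∞) :
    (∑' p : {p : ℕ × ℕ // p.2 ≤ p.1}, g p.1.1 * g p.1.2)
      = (∑' p : {p : ℕ × ℕ // p.2 < p.1}, g p.1.1 * g p.1.2) + ∑' n, g n ^ 2 := by
  have heq := tsum_diagonal g
  have hle := tsum_subtype {p : ℕ × ℕ | p.2 ≤ p.1} fun p => g p.1 * g p.2
  have hlt := tsum_subtype {p : ℕ × ℕ | p.2 < p.1} fun p => g p.1 * g p.2
  refine hle.trans ?_
  rw [← heq]
  refine Eq.trans ?_ (congrArg (· + _) hlt.symm)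
  rw [← ENNReal.tsum_add]
  congr 1
  ext ⟨m, n⟩
  rcases lt_trichotomy m n with h | h | h
  · simp [Set.indicator, h.not_ge, h.not_gt, h.ne]
  · simp [Set.indicator, h]
  · simp [Set.indicator, h.le, h, h.ne']

/-- The sum over `m > n ≥ 1` is finite and equals `(S² - S₂) / 2`, where `S = gaussSum c` and
`S₂ = gaussSum (2 c)`. -/
theorem tsum_lt_gauss {c : ℝ} (hc : 0 < c) :
    ∃ x : ℝ, 0 ≤ x ∧ 2 * x + gaussSum (2 * c) = gaussSum c ^ 2 ∧
      ∑' p : {p : ℕ × ℕ // p.2 < p.1}, ENNReal.ofReal (Real.exp (-c * ((p.1.1 : ℝ) + 1) ^ 2))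
        * ENNReal.ofReal (Real.exp (-c * ((p.1.2 : ℝ) + 1) ^ 2)) = ENNReal.ofReal x := by
  set g : ℕ → ℝ≥0∞ := fun n => ENNReal.ofReal (Real.exp (-c * ((n : ℝ) + 1) ^ 2))
  have h := tsum_sq_eq_two_mul_tsum_lt_add g
  have h1 : ∑' n, g n = ENNReal.ofReal (gaussSum c) :=
    (ENNReal.ofReal_tsum_of_nonneg (fun _ => (Real.exp_pos _).le) (summable_gaussSum hc)).symm
  have h2 : ∑' n, g n ^ 2 = ENNReal.ofReal (gaussSum (2 * c)) := by
    rw [gaussSum, ENNReal.ofReal_tsum_of_nonneg (fun _ => (Real.exp_pos _).le)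
      (summable_gaussSum (by positivity))]
    congr 1
    ext n
    rw [← ENNReal.ofReal_pow (Real.exp_pos _).le, ← Real.exp_nat_mul]
    congr 2
    push_cast
    ring
  rw [h1, h2] at h
  set D := ∑' p : {p : ℕ × ℕ // p.2 < p.1}, g p.1.1 * g p.1.2
  have hD : D ≠ ⊤ := by
    intro hD
    rw [hD] at h
    have : ENNReal.ofReal (gaussSum c) ^ 2 ≠ ⊤ := ENNReal.pow_ne_top ENNReal.ofReal_ne_top
    simp at h
  refine ⟨D.toReal, ENNReal.toReal_nonneg, ?_, (ENNReal.ofReal_toReal hD).symm⟩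
  have h' := congrArg ENNReal.toReal h
  rw [ENNReal.toReal_add (ENNReal.mul_ne_top (by simp) hD) ENNReal.ofReal_ne_top,
    ENNReal.toReal_mul, ENNReal.toReal_pow, ENNReal.toReal_ofReal (gaussSum_nonneg _),
    ENNReal.toReal_ofReal (gaussSum_nonneg _)] at h'
  simpa using h'.symm

/-- The sum over `m ≥ n ≥ 0` is finite and equals `(T² + T₂) / 2`, where `T = 1 + gaussSum c` and
`T₂ = 1 + gaussSum (2 c)`. -/
theorem tsum_le_gauss {c : ℝ} (hc : 0 < c) :
    ∃ x : ℝ, 0 ≤ x ∧ 2 * x = (1 + gaussSum c) ^ 2 + (1 + gaussSum (2 * c)) ∧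
      ∑' p : {p : ℕ × ℕ // p.2 ≤ p.1}, ENNReal.ofReal (Real.exp (-c * (p.1.1 : ℝ) ^ 2))
        * ENNReal.ofReal (Real.exp (-c * (p.1.2 : ℝ) ^ 2)) = ENNReal.ofReal x := by
  set g : ℕ → ℝ≥0∞ := fun n => ENNReal.ofReal (Real.exp (-c * (n : ℝ) ^ 2))
  have hsum : ∀ {b : ℝ}, 0 < b →
      ∑' n : ℕ, ENNReal.ofReal (Real.exp (-b * (n : ℝ) ^ 2)) = ENNReal.ofReal (1 + gaussSum b) := by
    intro b hb
    rw [tsum_eq_zero_add' ENNReal.summable, ENNReal.ofReal_add one_pos.le (gaussSum_nonneg b),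
      gaussSum, ENNReal.ofReal_tsum_of_nonneg (fun _ => (Real.exp_pos _).le) (summable_gaussSum hb)]
    simp
  have h := tsum_sq_eq_two_mul_tsum_lt_add g
  have hle := tsum_le_eq_tsum_lt_add g
  have h1 : ∑' n, g n = ENNReal.ofReal (1 + gaussSum c) := hsum hc
  have h2 : ∑' n, g n ^ 2 = ENNReal.ofReal (1 + gaussSum (2 * c)) := by
    rw [← hsum (by positivity)]
    congr 1
    ext n
    rw [← ENNReal.ofReal_pow (Real.exp_pos _).le, ← Real.exp_nat_mul]
    congr 2
    push_cast
    ring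
  have p1 := gaussSum_nonneg c
  have p2 := gaussSum_nonneg (2 * c)
  refine ⟨((1 + gaussSum c) ^ 2 + (1 + gaussSum (2 * c))) / 2, by positivity, by ring, ?_⟩
  have h3 : 2 * (∑' p : {p : ℕ × ℕ // p.2 ≤ p.1}, g p.1.1 * g p.1.2)
      = ENNReal.ofReal ((1 + gaussSum c) ^ 2 + (1 + gaussSum (2 * c))) := by
    rw [hle, ENNReal.ofReal_add (by positivity) (by positivity), ENNReal.ofReal_pow (by positivity),
      ← h1, h, ← h2]
    ring
  rw [ENNReal.ofReal_div_of_pos two_pos, ← h3, mul_comm, ENNReal.ofReal_ofNat,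
    ENNReal.mul_div_cancel_right (by simp) (by simp)]

/-! ### Smooth functions as Sobolev functions on a bounded open set -/

theorem partialDeriv_mul {i : Fin 2} {f g : Plane → ℝ} {x : Plane} (hf : DifferentiableAt ℝ f x)
    (hg : DifferentiableAt ℝ g x) :
    partialDeriv i (fun y => f y * g y) x
      = f x * partialDeriv i g x + partialDeriv i f x * g x := by
  rw [partialDeriv, fderiv_fun_mul hf hg]
  simp [partialDeriv, mul_comm]

theorem contDiff_partialDeriv {f : Plane → ℝ} (hf : ContDiff ℝ ∞ f) (i : Fin 2) :
    ContDiff ℝ ∞ (partialDeriv i f) :=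
  (hf.fderiv_right (by simp)).clm_apply contDiff_const

theorem isFiniteMeasure_restrict (hb : Bornology.IsBounded (Ω : Set Plane)) :
    IsFiniteMeasure ((volume : Measure Plane).restrict (Ω : Set Plane)) :=
  ⟨by simpa using hb.measure_lt_top⟩

theorem exists_bound_on (hb : Bornology.IsBounded (Ω : Set Plane)) {f : Plane → ℝ}
    (hf : Continuous f) : ∃ M, 0 ≤ M ∧ ∀ x ∈ Ω, |f x| ≤ M := by
  obtain ⟨M, hM⟩ := (hb.isCompact_closure).exists_bound_of_continuousOn hf.continuousOn
  exact ⟨max M 0, le_max_right _ _,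
    fun x hx => (hM x (subset_closure hx)).trans (le_max_left _ _)⟩

theorem memLp_of_continuous (hb : Bornology.IsBounded (Ω : Set Plane)) {f : Plane → ℝ}
    (hf : Continuous f) :
    MemLp f 2 ((volume : Measure Plane).restrict (Ω : Set Plane)) := by
  have := isFiniteMeasure_restrict hb
  obtain ⟨M, -, hM⟩ := exists_bound_on hb hf
  refine MemLp.of_bound hf.aestronglyMeasurable M ?_
  exact (ae_restrict_iff' Ω.isOpen.measurableSet).2 (ae_of_all _ fun x hx => hM x hx)

/-- The class in `L²(Ω)` of a continuous function on the plane, for bounded `Ω`. -/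
def toL2 (hb : Bornology.IsBounded (Ω : Set Plane)) (f : Plane → ℝ) (hf : Continuous f) : L2 Ω :=
  (memLp_of_continuous hb hf).toLp f

theorem coeFn_toL2 (hb : Bornology.IsBounded (Ω : Set Plane)) {f : Plane → ℝ} (hf : Continuous f) :
    toL2 hb f hf =ᵐ[(volume : Measure Plane).restrict (Ω : Set Plane)] f :=
  MemLp.coeFn_toLp _

theorem inner_toL2 (hb : Bornology.IsBounded (Ω : Set Plane)) {f : Plane → ℝ} (hf : Continuous f)
    (v : L2 Ω) : inner ℝ (toL2 hb f hf) v = ∫ x in (Ω : Set Plane), v x * f x := by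
  rw [L2.inner_def]
  refine integral_congr_ae ?_
  filter_upwards [coeFn_toL2 hb hf] with x hx
  simp [hx]

theorem integrable_mul_continuous (hb : Bornology.IsBounded (Ω : Set Plane)) {f : Plane → ℝ}
    (hf : Continuous f) (v : L2 Ω) :
    Integrable (fun x => v x * f x) ((volume : Measure Plane).restrict (Ω : Set Plane)) :=
  (Lp.memLp v).integrable_mul (memLp_of_continuous hb hf)

theorem isWeakPartial_toL2 (hb : Bornology.IsBounded (Ω : Set Plane)) {f : Plane → ℝ}
    (hf : ContDiff ℝ ∞ f) (i : Fin 2) :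
    IsWeakPartial i (toL2 hb f hf.continuous)
      (toL2 hb (partialDeriv i f) (contDiff_partialDeriv hf i).continuous) := by
  intro φ
  have h1 : ∫ x in (Ω : Set Plane), toL2 hb f hf.continuous x * partialDeriv i φ x
      = ∫ x in (Ω : Set Plane), f x * partialDeriv i φ x :=
    integral_congr_ae ((coeFn_toL2 hb _).mul (ae_eq_refl _))
  have h2 : ∫ x in (Ω : Set Plane),
        toL2 hb (partialDeriv i f) (contDiff_partialDeriv hf i).continuous x * φ x
      = ∫ x in (Ω : Set Plane), partialDeriv i f x * φ x :=
    integral_congr_ae ((coeFn_toL2 hb _).mul (ae_eq_refl _))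
  have hφ0 : ∀ x, x ∉ (Ω : Set Plane) → φ x = 0 := fun x hx =>
    image_eq_zero_of_notMem_tsupport fun h => hx (φ.tsupport_subset h)
  have hφ1 : ∀ x, x ∉ (Ω : Set Plane) → partialDeriv i φ x = 0 := fun x hx => by
    have : fderiv ℝ φ x = 0 := by
      have h := support_fderiv_subset ℝ (f := (φ : Plane → ℝ))
      by_contra hne
      exact hx (φ.tsupport_subset (h hne))
    simp [partialDeriv, this]
  rw [h1, h2, setIntegral_eq_integral_of_forall_compl_eq_zero fun x hx => by rw [hφ1 x hx, mul_zero],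
    setIntegral_eq_integral_of_forall_compl_eq_zero fun x hx => by rw [hφ0 x hx, mul_zero]]
  have hdφ : Continuous (partialDeriv i φ) := (contDiff_partialDeriv φ.contDiff i).continuous
  have hdf : Continuous (partialDeriv i f) := (contDiff_partialDeriv hf i).continuous
  have hsφ : HasCompactSupport (partialDeriv i φ) := φ.hasCompactSupport.fderiv_apply (𝕜 := ℝ) _
  refine integral_mul_fderiv_eq_neg_fderiv_mul_of_integrable
    ((hdf.mul φ.continuous).integrable_of_hasCompactSupport φ.hasCompactSupport.mul_left)
    ((hf.continuous.mul hdφ).integrable_of_hasCompactSupport hsφ.mul_left)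
    ((hf.continuous.mul φ.continuous).integrable_of_hasCompactSupport φ.hasCompactSupport.mul_left)
    (fun x _ => hf.differentiable (by simp) x) (fun x _ => φ.contDiff.differentiable (by simp) x)

/-- Bounded pointwise convergence implies convergence in `L²(Ω)`. -/
theorem tendsto_toL2 (hb : Bornology.IsBounded (Ω : Set Plane)) {F : ℕ → Plane → ℝ}
    {f : Plane → ℝ} (hF : ∀ n, Continuous (F n)) (hf : Continuous f) {K : ℝ}
    (hK : ∀ n, ∀ x ∈ Ω, |F n x| ≤ K) (hlim : ∀ x ∈ Ω, Tendsto (fun n => F n x) atTop (𝓝 (f x))) :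
    Tendsto (fun n => toL2 hb (F n) (hF n)) atTop (𝓝 (toL2 hb f hf)) := by
  have := isFiniteMeasure_restrict hb
  obtain ⟨M, -, hM⟩ := exists_bound_on hb hf
  rw [tendsto_iff_norm_sub_tendsto_zero]
  have hsq : ∀ n, ‖toL2 hb (F n) (hF n) - toL2 hb f hf‖
      = √(∫ x in (Ω : Set Plane), (F n x - f x) ^ 2) := by
    intro n
    rw [← Real.sqrt_sq (norm_nonneg (toL2 hb (F n) (hF n) - toL2 hb f hf)),
      ← real_inner_self_eq_norm_sq, L2.inner_def]
    congr 1
    refine integral_congr_ae ?_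
    filter_upwards [coeFn_toL2 hb hf, coeFn_toL2 hb (hF n),
      Lp.coeFn_sub (toL2 hb (F n) (hF n)) (toL2 hb f hf)] with x h1 h2 h3
    rw [h3, Pi.sub_apply, h1, h2]
    simp [sq]
  simp_rw [hsq]
  rw [← Real.sqrt_zero]
  refine (Real.continuous_sqrt.tendsto 0).comp ?_
  rw [show (0 : ℝ) = ∫ x in (Ω : Set Plane), (0 : ℝ) by simp]
  refine tendsto_integral_of_dominated_convergence (fun _ => (K + M) ^ 2)
    (fun n => (((hF n).sub hf).pow 2).aestronglyMeasurable) (integrable_const _) (fun n => ?_) ?_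
  · refine (ae_restrict_iff' Ω.isOpen.measurableSet).2 (ae_of_all _ fun x hx => ?_)
    rw [norm_pow, Real.norm_eq_abs]
    exact pow_le_pow_left₀ (abs_nonneg _)
      ((abs_sub _ _).trans (add_le_add (hK n x hx) (hM x hx))) 2
  · refine (ae_restrict_iff' Ω.isOpen.measurableSet).2 (ae_of_all _ fun x hx => ?_)
    have := ((hlim x hx).sub_const (f x)).pow 2
    simpa using this

/-! ### Cutoff functions on a polygon -/

/-- A smooth step: `0` up to `1`, and `1` from `2` on. -/
def step (s : ℝ) : ℝ := Real.smoothTransition (s - 1)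

theorem contDiff_step : ContDiff ℝ ∞ step :=
  Real.smoothTransition.contDiff.comp (contDiff_id.sub contDiff_const)

theorem step_nonneg (s : ℝ) : 0 ≤ step s := Real.smoothTransition.nonneg _

theorem step_le_one (s : ℝ) : step s ≤ 1 := Real.smoothTransition.le_one _

theorem step_eq_zero {s : ℝ} (hs : s ≤ 1) : step s = 0 :=
  Real.smoothTransition.zero_of_nonpos (by linarith)

theorem step_eq_one {s : ℝ} (hs : 2 ≤ s) : step s = 1 :=
  Real.smoothTransition.one_of_one_le (by linarith)

theorem deriv_step_of_lt {s : ℝ} (hs : s < 1) : deriv step s = 0 := by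
  have : step =ᶠ[𝓝 s] fun _ => 0 := by
    filter_upwards [Iio_mem_nhds hs] with y hy
    exact step_eq_zero (le_of_lt hy)
  rw [this.deriv_eq, deriv_const]

theorem deriv_step_of_gt {s : ℝ} (hs : 2 < s) : deriv step s = 0 := by
  have : step =ᶠ[𝓝 s] fun _ => 1 := by
    filter_upwards [Ioi_mem_nhds hs] with y hy
    exact step_eq_one (le_of_lt hy)
  rw [this.deriv_eq, deriv_const]

theorem exists_bound_mul_deriv_step : ∃ C, ∀ s : ℝ, |s * deriv step s| ≤ C := by
  have hc : Continuous fun s : ℝ => s * deriv step s :=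
    continuous_id.mul (contDiff_step.continuous_deriv (by simp))
  refine hc.bounded_above_of_compact_support
    (HasCompactSupport.intro (isCompact_Icc (a := (1 : ℝ)) (b := 2)) fun s hs => ?_)
  rw [Set.mem_Icc, not_and_or, not_le, not_le] at hs
  rcases hs with hs | hs
  · rw [deriv_step_of_lt hs, mul_zero]
  · rw [deriv_step_of_gt hs, mul_zero]

variable {ι : Type*} (ν : ι → Plane) (c : ι → ℝ)

/-- The affine functions `x ↦ ⟨ν j, x⟩ + c j` cutting out the half planes of a polygon. -/
def side (j : ι) (x : Plane) : ℝ := inner ℝ (ν j) x + c j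

/-- A smooth cutoff that vanishes where some side function is below `1 / n`, and is `1` where all
of them exceed `2 / n`. -/
def cutoff [Fintype ι] (n : ℕ) (x : Plane) : ℝ := ∏ j, step (n * side ν c j x)

/-- The coefficient of `ν j` in the gradient of `cutoff ν c n`. -/
def cutoffSlope [Fintype ι] [DecidableEq ι] (n : ℕ) (j : ι) (x : Plane) : ℝ :=
  (∏ l ∈ Finset.univ.erase j, step (n * side ν c l x)) * (n * deriv step (n * side ν c j x))

theorem contDiff_side (j : ι) : ContDiff ℝ ∞ (side ν c j) :=
  (contDiff_const.inner ℝ contDiff_id).add contDiff_const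

theorem contDiff_cutoff [Fintype ι] (n : ℕ) : ContDiff ℝ ∞ (cutoff ν c n) :=
  contDiff_prod fun j _ => contDiff_step.comp (contDiff_const.mul (contDiff_side ν c j))

theorem cutoff_nonneg [Fintype ι] (n : ℕ) (x : Plane) : 0 ≤ cutoff ν c n x :=
  Finset.prod_nonneg fun _ _ => step_nonneg _

theorem cutoff_le_one [Fintype ι] (n : ℕ) (x : Plane) : cutoff ν c n x ≤ 1 :=
  Finset.prod_le_one (fun _ _ => step_nonneg _) fun _ _ => step_le_one _

theorem hasFDerivAt_side (j : ι) (x : Plane) :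
    HasFDerivAt (side ν c j) (innerSL ℝ (ν j)) x :=
  ((innerSL ℝ (ν j)).hasFDerivAt (x := x)).add_const (c j)

theorem partialDeriv_cutoff [Fintype ι] [DecidableEq ι] (n : ℕ) (i : Fin 2) (x : Plane) :
    partialDeriv i (cutoff ν c n) x = ∑ j, cutoffSlope ν c n j x * ν j i := by
  have h : ∀ j ∈ (Finset.univ : Finset ι), HasFDerivAt (fun y => step (n * side ν c j y))
      (deriv step (n * side ν c j x) • ((n : ℝ) • innerSL ℝ (ν j))) x := fun j _ =>
    ((contDiff_step.differentiable (by simp) _).hasDerivAt).comp_hasFDerivAt x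
      ((hasFDerivAt_side ν c j x).const_mul (n : ℝ))
  have h' := HasFDerivAt.finsetProd h
  rw [partialDeriv, show cutoff ν c n = fun y => ∏ j, step (n * side ν c j y) from rfl, h'.fderiv]
  simp only [_root_.sum_apply, _root_.smul_apply, innerSL_apply_apply,
    EuclideanSpace.inner_single_right, smul_eq_mul]
  refine Finset.sum_congr rfl fun j _ => ?_
  simp [cutoffSlope]
  ring

variable {ν c}

theorem tendsto_mul_side {x : Plane} {j : ι} (hx : 0 < side ν c j x) :
    Tendsto (fun n : ℕ => (n : ℝ) * side ν c j x) atTop atTop :=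
  tendsto_natCast_atTop_atTop.atTop_mul_const hx

theorem eventually_cutoff_eq_one [Fintype ι] {x : Plane} (hx : ∀ j, 0 < side ν c j x) :
    ∀ᶠ n in atTop, cutoff ν c n x = 1 := by
  have : ∀ᶠ n : ℕ in atTop, ∀ j, 2 ≤ (n : ℝ) * side ν c j x :=
    eventually_all.2 fun j => (tendsto_mul_side (hx j)).eventually_ge_atTop 2
  filter_upwards [this] with n hn
  exact Finset.prod_eq_one fun j _ => step_eq_one (hn j)

theorem eventually_cutoffSlope_eq_zero [Fintype ι] [DecidableEq ι] {x : Plane} {j : ι} (hx : 0 < side ν c j x) :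
    ∀ᶠ n in atTop, cutoffSlope ν c n j x = 0 := by
  filter_upwards [(tendsto_mul_side hx).eventually_gt_atTop 2] with n hn
  rw [cutoffSlope, deriv_step_of_gt hn, mul_zero, mul_zero]

/-- The slope of the cutoff is at most a constant over the distance to the side. -/
theorem exists_cutoffSlope_bound [Fintype ι] [DecidableEq ι] (ν : ι → Plane) (c : ι → ℝ) :
    ∃ C, 0 ≤ C ∧ ∀ n j x, 0 < side ν c j x → ∀ y D : ℝ, |y| ≤ D * side ν c j x →
      |cutoffSlope ν c n j x * y| ≤ C * D := by
  obtain ⟨C, hC⟩ := exists_bound_mul_deriv_step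
  have hC0 : 0 ≤ C := (abs_nonneg _).trans (hC 0)
  refine ⟨C, hC0, fun n j x h0 y D hy => ?_⟩
  have hD : 0 ≤ D := nonneg_of_mul_nonneg_left ((abs_nonneg y).trans hy) h0
  have hp0 : 0 ≤ ∏ l ∈ Finset.univ.erase j, step (n * side ν c l x) :=
    Finset.prod_nonneg fun _ _ => step_nonneg _
  have hp1 : ∏ l ∈ Finset.univ.erase j, step (n * side ν c l x) ≤ 1 :=
    Finset.prod_le_one (fun _ _ => step_nonneg _) fun _ _ => step_le_one _
  rw [cutoffSlope, abs_mul, abs_mul, abs_of_nonneg hp0]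
  calc _ ≤ 1 * |(n : ℝ) * deriv step (n * side ν c j x)| * (D * side ν c j x) := by gcongr
    _ = |(n * side ν c j x) * deriv step (n * side ν c j x)| * D := by
        simp only [abs_mul, abs_of_pos h0]; ring
    _ ≤ C * D := by gcongr; exact hC _

/-- A smooth function times the cutoff is a test function on the polygon. -/
def cutoffTest [Fintype ι] (hΩ : ∀ x, x ∈ Ω ↔ ∀ j, 0 < side ν c j x)
    (hb : Bornology.IsBounded (Ω : Set Plane)) (n : ℕ) (f : Plane → ℝ) (hf : ContDiff ℝ ∞ f) :
    𝓓(Ω, ℝ) :=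
  have hclosed : IsClosed {x : Plane | ∀ j, 1 ≤ (n : ℝ) * side ν c j x} := by
    rw [Set.ofPred_forall]
    exact isClosed_iInter fun j =>
      isClosed_le continuous_const (continuous_const.mul (contDiff_side ν c j).continuous)
  have hsub : {x : Plane | ∀ j, 1 ≤ (n : ℝ) * side ν c j x} ⊆ Ω := fun x hx =>
    (hΩ x).2 fun j => pos_of_mul_pos_right (one_pos.trans_le (hx j)) n.cast_nonneg
  have hsupp : tsupport (fun x => cutoff ν c n x * f x)
      ⊆ {x : Plane | ∀ j, 1 ≤ (n : ℝ) * side ν c j x} := by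
    refine closure_minimal (fun x hx j => ?_) hclosed
    by_contra hlt
    refine hx ?_
    have : cutoff ν c n x = 0 :=
      Finset.prod_eq_zero (Finset.mem_univ j) (step_eq_zero (not_le.1 hlt).le)
    simp [this]
  { toFun := fun x => cutoff ν c n x * f x
    contDiff' := (contDiff_cutoff ν c n).mul hf
    hasCompactSupport' := (Metric.isCompact_of_isClosed_isBounded hclosed
      (hb.subset hsub)).of_isClosed_subset (isClosed_tsupport _) hsupp
    tsupport_subset' := hsupp.trans hsub }

theorem partialDeriv_cutoff_mul [Fintype ι] [DecidableEq ι] (n : ℕ) (i : Fin 2) {f : Plane → ℝ}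
    (hf : ContDiff ℝ ∞ f) (x : Plane) :
    partialDeriv i (fun y => cutoff ν c n y * f y) x
      = cutoff ν c n x * partialDeriv i f x + (∑ j, cutoffSlope ν c n j x * (ν j i * f x)) := by
  rw [partialDeriv_mul ((contDiff_cutoff ν c n).differentiable (by simp) x)
    (hf.differentiable (by simp) x), partialDeriv_cutoff, Finset.sum_mul]
  simp only [mul_assoc]

/-- Green's formula `∫ ∇v · X + ∫ v div X = 0` for `v ∈ H¹(Ω)` and a smooth vector field `X` that
is tangential to the boundary of the polygon. Multiplying `X` by a cutoff makes it a test field;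
the gradient of the cutoff is normal to a side, so it only sees the component of `X` that vanishes
there, and stays bounded. -/
theorem integral_grad_add_integral_div_eq_zero [Fintype ι]
    (hΩ : ∀ x, x ∈ Ω ↔ ∀ j, 0 < side ν c j x)
    (hb : Bornology.IsBounded (Ω : Set Plane)) {X : Fin 2 → Plane → ℝ}
    (hX : ∀ i, ContDiff ℝ ∞ (X i)) {D : ℝ}
    (htan : ∀ j, ∀ x ∈ Ω, |∑ i, ν j i * X i x| ≤ D * side ν c j x)
    {v : L2 Ω} {g : Fin 2 → L2 Ω} (hv : IsH1 v g) :
    (∑ i, ∫ x in (Ω : Set Plane), g i x * X i x)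
      + ∫ x in (Ω : Set Plane), v x * ∑ i, partialDeriv i (X i) x = 0 := by
  classical
  have := isFiniteMeasure_restrict hb
  have hdX : ∀ i, Continuous (partialDeriv i (X i)) :=
    fun i => (contDiff_partialDeriv (hX i) i).continuous
  have hdiv : Continuous fun x => ∑ i, partialDeriv i (X i) x :=
    continuous_finsetSum _ fun i _ => hdX i
  obtain ⟨C, hC0, hC⟩ := exists_cutoffSlope_bound ν c
  obtain ⟨M, hM0, hM⟩ := exists_bound_on hb hdiv
  have hΩm : MeasurableSet (Ω : Set Plane) := Ω.isOpen.measurableSet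
  -- the divergence of the truncated field
  set T : ℕ → Plane → ℝ := fun n x => ∑ i, partialDeriv i (fun y => cutoff ν c n y * X i y) x
  have hT : ∀ n x, T n x = cutoff ν c n x * (∑ i, partialDeriv i (X i) x)
      + ∑ j, cutoffSlope ν c n j x * ∑ i, ν j i * X i x := by
    intro n x
    simp only [T, partialDeriv_cutoff_mul n _ (hX _), Finset.sum_add_distrib, Finset.mul_sum]
    congr 1
    exact Finset.sum_comm
  have hTc : ∀ n, Continuous (T n) := fun n => continuous_finsetSum _ fun i _ =>
    (contDiff_partialDeriv ((contDiff_cutoff ν c n).mul (hX i)) i).continuous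
  have hweak : ∀ n, ∫ x in (Ω : Set Plane), v x * T n x
      = - ∑ i, ∫ x in (Ω : Set Plane), g i x * (cutoff ν c n x * X i x) := by
    intro n
    simp only [T, Finset.mul_sum]
    rw [integral_finsetSum _ fun i _ => integrable_mul_continuous hb
      (contDiff_partialDeriv ((contDiff_cutoff ν c n).mul (hX i)) i).continuous v,
      ← Finset.sum_neg_distrib]
    exact Finset.sum_congr rfl fun i _ => hv i (cutoffTest hΩ hb n (X i) (hX i))
  have hlim1 : Tendsto (fun n => ∫ x in (Ω : Set Plane), v x * T n x) atTop
      (𝓝 (∫ x in (Ω : Set Plane), v x * ∑ i, partialDeriv i (X i) x)) := by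
    refine tendsto_integral_of_dominated_convergence
      (fun x => |v x| * (M + ∑ _j : ι, C * D))
      (fun n => (integrable_mul_continuous hb (hTc n) v).aestronglyMeasurable)
      ((((Lp.memLp v).integrable (by norm_num)).norm).mul_const _) (fun n => ?_) ?_
    · refine (ae_restrict_iff' hΩm).2 (ae_of_all _ fun x hx => ?_)
      rw [Real.norm_eq_abs, abs_mul, hT]
      refine mul_le_mul_of_nonneg_left ((abs_add_le _ _).trans (add_le_add ?_ ?_)) (abs_nonneg _)
      · rw [abs_mul, abs_of_nonneg (cutoff_nonneg ν c n x)]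
        calc _ ≤ 1 * M := mul_le_mul (cutoff_le_one ν c n x) (hM x hx) (abs_nonneg _) one_pos.le
          _ = M := one_mul M
      -- the blow-up of the cutoff is compensated by the tangency of the field
      · exact (Finset.abs_sum_le_sum_abs _ _).trans (Finset.sum_le_sum fun j _ =>
          hC n j x ((hΩ x).1 hx j) _ D (htan j x hx))
    · refine (ae_restrict_iff' hΩm).2 (ae_of_all _ fun x hx => ?_)
      refine tendsto_const_nhds.congr' ?_
      have h0 : ∀ᶠ n in atTop, ∀ j, cutoffSlope ν c n j x = 0 :=
        eventually_all.2 fun j => eventually_cutoffSlope_eq_zero ((hΩ x).1 hx j)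
      filter_upwards [eventually_cutoff_eq_one ((hΩ x).1 hx), h0] with n h1 h2
      rw [hT, h1]
      simp [h2]
  have hlim2 : ∀ i, Tendsto (fun n => ∫ x in (Ω : Set Plane), g i x * (cutoff ν c n x * X i x))
      atTop (𝓝 (∫ x in (Ω : Set Plane), g i x * X i x)) := by
    intro i
    refine tendsto_integral_of_dominated_convergence (fun x => |g i x * X i x|)
      (fun n => (integrable_mul_continuous hb
        ((contDiff_cutoff ν c n).mul (hX i)).continuous (g i)).aestronglyMeasurable)
      (integrable_mul_continuous hb (hX i).continuous (g i)).norm (fun n => ?_) ?_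
    · refine ae_of_all _ fun x => ?_
      rw [Real.norm_eq_abs, mul_left_comm, abs_mul, abs_of_nonneg (cutoff_nonneg ν c n x)]
      exact mul_le_of_le_one_left (abs_nonneg _) (cutoff_le_one ν c n x)
    · refine (ae_restrict_iff' hΩm).2 (ae_of_all _ fun x hx => ?_)
      refine tendsto_const_nhds.congr' ?_
      filter_upwards [eventually_cutoff_eq_one ((hΩ x).1 hx)] with n h1
      rw [h1, one_mul]
  have hlim := hlim1.congr hweak
  have hlim' := (tendsto_finsetSum Finset.univ fun i _ => hlim2 i).neg
  rw [tendsto_nhds_unique hlim hlim', add_neg_cancel]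

/-- A smooth function that vanishes on the boundary of the polygon belongs to `H¹₀(Ω)`. -/
theorem toL2_mem_sobolevZeroGraph [Fintype ι]
    (hΩ : ∀ x, x ∈ Ω ↔ ∀ j, 0 < side ν c j x)
    (hb : Bornology.IsBounded (Ω : Set Plane)) {f : Plane → ℝ} (hf : ContDiff ℝ ∞ f) {D : ℝ}
    (hzero : ∀ j, ∀ x ∈ Ω, |f x| ≤ D * side ν c j x) :
    (toL2 hb f hf.continuous,
      fun i => toL2 hb (partialDeriv i f) (contDiff_partialDeriv hf i).continuous)
        ∈ sobolevZeroGraph Ω := by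
  classical
  obtain ⟨C, hC0, hC⟩ := exists_cutoffSlope_bound ν c
  obtain ⟨M, hM0, hM⟩ := exists_bound_on hb hf.continuous
  have hcf : ∀ n, ContDiff ℝ ∞ fun x => cutoff ν c n x * f x :=
    fun n => (contDiff_cutoff ν c n).mul hf
  let u : ℕ → L2 Ω × (Fin 2 → L2 Ω) := fun n => (toL2 hb _ (hcf n).continuous,
    fun i => toL2 hb _ (contDiff_partialDeriv (hcf n) i).continuous)
  refine mem_closure_of_tendsto (f := u) (b := atTop) (Tendsto.prodMk_nhds ?_ ?_) ?_
  · refine tendsto_toL2 hb _ _ (K := M) (fun n x hx => ?_) fun x hx => ?_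
    · rw [abs_mul, abs_of_nonneg (cutoff_nonneg ν c n x)]
      exact (mul_le_of_le_one_left (abs_nonneg _) (cutoff_le_one ν c n x)).trans (hM x hx)
    · refine tendsto_const_nhds.congr' ?_
      filter_upwards [eventually_cutoff_eq_one ((hΩ x).1 hx)] with n h1
      rw [h1, one_mul]
  · refine tendsto_pi_nhds.2 fun i => ?_
    obtain ⟨M', hM0', hM'⟩ := exists_bound_on hb (contDiff_partialDeriv hf i).continuous
    refine tendsto_toL2 hb _ _ (K := M' + ∑ j, C * (|ν j i| * D)) (fun n x hx => ?_) fun x hx => ?_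
    · rw [partialDeriv_cutoff_mul n i hf]
      refine (abs_add_le _ _).trans (add_le_add ?_ ?_)
      · rw [abs_mul, abs_of_nonneg (cutoff_nonneg ν c n x)]
        exact (mul_le_of_le_one_left (abs_nonneg _) (cutoff_le_one ν c n x)).trans (hM' x hx)
      · refine (Finset.abs_sum_le_sum_abs _ _).trans (Finset.sum_le_sum fun j _ =>
          hC n j x ((hΩ x).1 hx j) _ _ ?_)
        rw [abs_mul, mul_assoc]
        exact mul_le_mul_of_nonneg_left (hzero j x hx) (abs_nonneg _)
    · refine tendsto_const_nhds.congr' ?_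
      have h0 : ∀ᶠ n in atTop, ∀ j, cutoffSlope ν c n j x = 0 :=
        eventually_all.2 fun j => eventually_cutoffSlope_eq_zero ((hΩ x).1 hx j)
      filter_upwards [eventually_cutoff_eq_one ((hΩ x).1 hx), h0] with n h1 h2
      rw [partialDeriv_cutoff_mul n i hf, h1]
      simp [h2]
  · exact Eventually.of_forall fun n => ⟨cutoffTest hΩ hb n f hf, coeFn_toL2 hb (hcf n).continuous,
      fun i => coeFn_toL2 hb (contDiff_partialDeriv (hcf n) i).continuous⟩

/-! ### Orthogonality of eigenspaces -/

/-- Green's formula `∫ ∇w · G + ∫ w div G = 0` for `w ∈ H¹₀(Ω)` and a weakly differentiable field `G`: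
it is the definition of the weak derivatives of `G` for a test function `w`, and both sides are
continuous in `(w, ∇w)`. -/
theorem inner_grad_add_inner_div_eq_zero {w : L2 Ω} {k : Fin 2 → L2 Ω}
    (hw : (w, k) ∈ sobolevZeroGraph Ω) {G H : Fin 2 → L2 Ω}
    (hG : ∀ i, IsWeakPartial i (G i) (H i)) :
    (∑ i, inner ℝ (k i) (G i)) + inner ℝ w (∑ i, H i) = 0 := by
  have hclosed : IsClosed {p : L2 Ω × (Fin 2 → L2 Ω) |
      (∑ i, inner ℝ (p.2 i) (G i)) + inner ℝ p.1 (∑ i, H i) = 0} :=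
    isClosed_eq (by fun_prop) continuous_const
  refine closure_minimal (s := (testGraph Ω : Set (L2 Ω × (Fin 2 → L2 Ω)))) ?_ hclosed hw
  rintro ⟨w, k⟩ ⟨φ, h0, h1⟩
  have e1 : ∀ i, inner ℝ (k i) (G i) = ∫ x in (Ω : Set Plane), G i x * partialDeriv i φ x := by
    intro i
    rw [L2.inner_def]
    refine integral_congr_ae ?_
    filter_upwards [h1 i] with x hx
    simp [hx]
  have e2 : ∀ i, inner ℝ w (H i) = ∫ x in (Ω : Set Plane), H i x * φ x := by
    intro i
    rw [L2.inner_def]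
    refine integral_congr_ae ?_
    filter_upwards [h0] with x hx
    simp [hx]
  change (∑ i, inner ℝ (k i) (G i)) + inner ℝ w (∑ i, H i) = 0
  rw [inner_sum, ← Finset.sum_add_distrib]
  refine Finset.sum_eq_zero fun i _ => ?_
  rw [e1, e2, hG i φ, neg_add_cancel]

/-- Green's formula applied to `(u, ∇v)` and to `(v, ∇u)` gives `lam ⟪v, u⟫ = μ ⟪v, u⟫`. -/
theorem dirichletEigenspace_inner_eq_zero {lam μ : ℝ} {u v : L2 Ω}
    (hu : u ∈ dirichletEigenspace Ω lam) (hv : v ∈ dirichletEigenspace Ω μ) (h : μ ≠ lam) :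
    inner ℝ v u = 0 := by
  obtain ⟨g, d, ⟨-, hd⟩, hz, he⟩ := hu
  obtain ⟨g', d', ⟨-, hd'⟩, hz', he'⟩ := hv
  have h1 := inner_grad_add_inner_div_eq_zero hz fun i => hd' i i
  have h2 := inner_grad_add_inner_div_eq_zero hz' fun i => hd i i
  rw [eq_neg_of_add_eq_zero_left he', inner_neg_right, real_inner_smul_right] at h1
  rw [eq_neg_of_add_eq_zero_left he, inner_neg_right, real_inner_smul_right] at h2
  simp only [real_inner_comm] at h1 h2
  have : (μ - lam) * inner ℝ v u = 0 := by
    have e : ∑ i, inner ℝ (g i) (g' i) = ∑ i, inner ℝ (g' i) (g i) :=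
      Finset.sum_congr rfl fun i _ => real_inner_comm _ _
    have e' : inner ℝ u v = inner ℝ v u := real_inner_comm _ _
    simp only [e, e'] at h1 h2
    linarith
  exact (mul_eq_zero.1 this).resolve_left (sub_ne_zero.2 h)

/-- The boundary condition of `u` tested with `v`, and of `v` tested with `u`, gives
`lam ⟪v, u⟫ = μ ⟪v, u⟫`. -/
theorem neumannEigenspace_inner_eq_zero {lam μ : ℝ} {u v : L2 Ω}
    (hu : u ∈ neumannEigenspace Ω lam) (hv : v ∈ neumannEigenspace Ω μ) (h : μ ≠ lam) :
    inner ℝ v u = 0 := by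
  obtain ⟨g, d, ⟨hg, -⟩, hz, he⟩ := hu
  obtain ⟨g', d', ⟨hg', -⟩, hz', he'⟩ := hv
  have h1 := hz v g' hg'
  have h2 := hz' u g hg
  rw [eq_neg_of_add_eq_zero_left he, inner_neg_left, real_inner_smul_left] at h1
  rw [eq_neg_of_add_eq_zero_left he', inner_neg_left, real_inner_smul_left] at h2
  have : (μ - lam) * inner ℝ v u = 0 := by
    have e : ∑ i, inner ℝ (g i) (g' i) = ∑ i, inner ℝ (g' i) (g i) :=
      Finset.sum_congr rfl fun i _ => real_inner_comm _ _
    have e' : inner ℝ u v = inner ℝ v u := real_inner_comm _ _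
    simp only [e, e'] at h1 h2
    linarith
  exact (mul_eq_zero.1 this).resolve_left (sub_ne_zero.2 h)

/-! ### Coordinates adapted to the triangle -/

section Coordinates

variable (b : OrthonormalBasis (Fin 2) ℝ Plane) (q : Plane) (a : ℝ)

/-- The `k`-th coordinate with respect to the orthonormal frame `b` at the origin `q`. -/
def coord (k : Fin 2) (x : Plane) : ℝ := inner ℝ (b k) (x - q)

/-- `Ω` is the triangle `0 < Y < X < a` in the coordinates `X`, `Y` of the frame `b` at `q`. -/
def IsCoordTriangle (Ω : TopologicalSpace.Opens Plane) : Prop :=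
  ∀ x, x ∈ Ω ↔ 0 < coord b q 1 x ∧ coord b q 1 x < coord b q 0 x ∧ coord b q 0 x < a

/-- Inner normals of the sides `Y = 0`, `X = Y`, `X = a`; the second one is not normalised. -/
def triNormal : Fin 3 → Plane := ![b 1, b 0 - b 1, -b 0]

/-- The constant terms of the side functions `Y`, `X - Y`, `a - X`. -/
def triOffset : Fin 3 → ℝ :=
  ![-inner ℝ (b 1) q, -inner ℝ (b 0) q + inner ℝ (b 1) q, inner ℝ (b 0) q + a]

theorem side_zero (x : Plane) : side (triNormal b) (triOffset b q a) 0 x = coord b q 1 x := by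
  simp [side, triNormal, triOffset, coord, inner_sub_right, ← sub_eq_add_neg]

theorem side_one (x : Plane) :
    side (triNormal b) (triOffset b q a) 1 x = coord b q 0 x - coord b q 1 x := by
  simp [side, triNormal, triOffset, coord, inner_sub_right, inner_sub_left]
  ring

theorem side_two (x : Plane) :
    side (triNormal b) (triOffset b q a) 2 x = a - coord b q 0 x := by
  simp [side, triNormal, triOffset, coord, inner_sub_right]
  ring

variable {b q a}

theorem IsCoordTriangle.mem_iff_side (hΩ : IsCoordTriangle b q a Ω) (x : Plane) :
    x ∈ Ω ↔ ∀ j, 0 < side (triNormal b) (triOffset b q a) j x := by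
  rw [hΩ x, Fin.forall_fin_succ, Fin.forall_fin_two]
  change _ ↔ 0 < side _ _ 0 x ∧ 0 < side _ _ 1 x ∧ 0 < side _ _ 2 x
  rw [side_zero, side_one, side_two, sub_pos, sub_pos]

theorem norm_sub_sq_eq (x : Plane) :
    ‖x - q‖ ^ 2 = coord b q 0 x ^ 2 + coord b q 1 x ^ 2 := by
  rw [← b.sum_sq_norm_inner_right (x - q), Fin.sum_univ_two]
  simp [coord]

theorem IsCoordTriangle.isBounded (hΩ : IsCoordTriangle b q a Ω) :
    Bornology.IsBounded (Ω : Set Plane) := by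
  refine (Metric.isBounded_closedBall (x := q) (r := √(2 * a ^ 2))).subset fun x hx => ?_
  obtain ⟨h1, h2, h3⟩ := (hΩ x).1 hx
  rw [Metric.mem_closedBall, dist_eq_norm]
  refine Real.le_sqrt_of_sq_le ?_
  rw [norm_sub_sq_eq (b := b)]
  nlinarith

variable (b q) in
/-- The function `α(X) β(Y)`. -/
def tens (α β : ℝ → ℝ) (x : Plane) : ℝ := α (coord b q 0 x) * β (coord b q 1 x)

theorem contDiff_coord (k : Fin 2) : ContDiff ℝ ∞ (coord b q k) :=
  contDiff_const.inner ℝ (contDiff_id.sub contDiff_const)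

theorem contDiff_tens {α β : ℝ → ℝ} (hα : ContDiff ℝ ∞ α) (hβ : ContDiff ℝ ∞ β) :
    ContDiff ℝ ∞ (tens b q α β) :=
  (hα.comp (contDiff_coord 0)).mul (hβ.comp (contDiff_coord 1))

theorem hasFDerivAt_coord (k : Fin 2) (x : Plane) :
    HasFDerivAt (coord b q k) (innerSL ℝ (b k)) x :=
  (innerSL ℝ (b k)).hasFDerivAt.comp x ((hasFDerivAt_id x).sub_const q)

theorem partialDeriv_comp_coord {α : ℝ → ℝ} (hα : ContDiff ℝ ∞ α) (k i : Fin 2) (x : Plane) :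
    partialDeriv i (fun y => α (coord b q k y)) x = b k i * deriv α (coord b q k x) := by
  have h := ((hα.differentiable (by simp) (coord b q k x)).hasDerivAt).comp_hasFDerivAt x
    (hasFDerivAt_coord (b := b) (q := q) k x)
  rw [partialDeriv, show (fun y => α (coord b q k y)) = α ∘ coord b q k from rfl, h.fderiv]
  simp [EuclideanSpace.inner_single_right, mul_comm]

theorem partialDeriv_tens {α β : ℝ → ℝ} (hα : ContDiff ℝ ∞ α) (hβ : ContDiff ℝ ∞ β) (i : Fin 2) :
    partialDeriv i (tens b q α β)
      = fun x => b 0 i * tens b q (deriv α) β x + b 1 i * tens b q α (deriv β) x := by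
  ext x
  have h1 := (hα.comp (contDiff_coord (b := b) (q := q) 0)).differentiable (by simp) x
  have h2 := (hβ.comp (contDiff_coord (b := b) (q := q) 1)).differentiable (by simp) x
  have := partialDeriv_mul (i := i) h1 h2
  simp only [Function.comp_apply] at this
  rw [show tens b q α β = fun y => α (coord b q 0 y) * β (coord b q 1 y) from rfl, this]
  have e1 := partialDeriv_comp_coord (b := b) (q := q) hα 0 i x
  have e2 := partialDeriv_comp_coord (b := b) (q := q) hβ 1 i x
  simp only [Function.comp_def]
  rw [e1, e2]
  simp only [tens]
  ring

theorem partialDeriv_linear {f g : Plane → ℝ} (hf : ContDiff ℝ ∞ f) (hg : ContDiff ℝ ∞ g) (s t : ℝ)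
    (i : Fin 2) (x : Plane) :
    partialDeriv i (fun y => s * f y + t * g y) x = s * partialDeriv i f x + t * partialDeriv i g x := by
  have h1 := (hf.differentiable (by simp) x).const_mul s
  have h2 := (hg.differentiable (by simp) x).const_mul t
  rw [partialDeriv, fderiv_fun_add h1 h2, fderiv_const_mul (hf.differentiable (by simp) x),
    fderiv_const_mul (hg.differentiable (by simp) x)]
  simp [partialDeriv]

theorem sum_basis_mul (k l : Fin 2) : ∑ i, b k i * b l i = if k = l then 1 else 0 := by
  have h := orthonormal_iff_ite.1 b.orthonormal k l
  rw [← h, EuclideanSpace.inner_eq_star_dotProduct]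
  simp [dotProduct, mul_comm]

theorem contDiff_deriv {α : ℝ → ℝ} (hα : ContDiff ℝ ∞ α) : ContDiff ℝ ∞ (deriv α) :=
  (contDiff_infty_iff_deriv.1 hα).2

theorem laplacian_tens {α β : ℝ → ℝ} (hα : ContDiff ℝ ∞ α) (hβ : ContDiff ℝ ∞ β) (x : Plane) :
    ∑ i, partialDeriv i (partialDeriv i (tens b q α β)) x
      = tens b q (deriv (deriv α)) β x + tens b q α (deriv (deriv β)) x := by
  have hα' := contDiff_deriv hα
  have hβ' := contDiff_deriv hβ
  have h : ∀ i, partialDeriv i (partialDeriv i (tens b q α β)) x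
      = (b 0 i * b 0 i) * tens b q (deriv (deriv α)) β x
        + 2 * (b 0 i * b 1 i) * tens b q (deriv α) (deriv β) x
        + (b 1 i * b 1 i) * tens b q α (deriv (deriv β)) x := by
    intro i
    rw [partialDeriv_tens hα hβ, partialDeriv_linear (contDiff_tens hα' hβ) (contDiff_tens hα hβ'),
      partialDeriv_tens hα' hβ, partialDeriv_tens hα hβ']
    ring
  have h00 := sum_basis_mul (b := b) 0 0
  have h01 := sum_basis_mul (b := b) 0 1
  have h11 := sum_basis_mul (b := b) 1 1
  simp only [h, Finset.sum_add_distrib, ← Finset.sum_mul, ← Finset.mul_sum, h00, h01, h11]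
  simp

variable (b q) in
/-- The function `α(X) β(Y) + σ β(X) α(Y)`: for `σ = 1` the symmetrisation, for `σ = -1` the
antisymmetrisation of `α(X) β(Y)`. -/
def pairFun (σ : ℝ) (α β : ℝ → ℝ) (x : Plane) : ℝ := tens b q α β x + σ * tens b q β α x

theorem contDiff_pairFun (σ : ℝ) {α β : ℝ → ℝ} (hα : ContDiff ℝ ∞ α) (hβ : ContDiff ℝ ∞ β) :
    ContDiff ℝ ∞ (pairFun b q σ α β) :=
  (contDiff_tens hα hβ).add (contDiff_const.mul (contDiff_tens hβ hα))

theorem partialDeriv_pairFun (σ : ℝ) {α β : ℝ → ℝ} (hα : ContDiff ℝ ∞ α) (hβ : ContDiff ℝ ∞ β)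
    (i : Fin 2) : partialDeriv i (pairFun b q σ α β)
      = fun x => 1 * partialDeriv i (tens b q α β) x + σ * partialDeriv i (tens b q β α) x := by
  ext x
  rw [← partialDeriv_linear (contDiff_tens hα hβ) (contDiff_tens hβ hα)]
  congr 1
  funext y
  rw [pairFun, one_mul]

theorem laplacian_pairFun (σ : ℝ) {α β : ℝ → ℝ} (hα : ContDiff ℝ ∞ α) (hβ : ContDiff ℝ ∞ β)
    {A B : ℝ} (hA : ∀ s, deriv (deriv α) s = -A * α s) (hB : ∀ s, deriv (deriv β) s = -B * β s)
    (x : Plane) :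
    ∑ i, partialDeriv i (partialDeriv i (pairFun b q σ α β)) x
      = -(A + B) * pairFun b q σ α β x := by
  have h : ∀ i, partialDeriv i (partialDeriv i (pairFun b q σ α β)) x
      = 1 * partialDeriv i (partialDeriv i (tens b q α β)) x
        + σ * partialDeriv i (partialDeriv i (tens b q β α)) x := fun i => by
    rw [partialDeriv_pairFun σ hα hβ, partialDeriv_linear
      (contDiff_partialDeriv (contDiff_tens hα hβ) i) (contDiff_partialDeriv (contDiff_tens hβ hα) i)]
  simp only [h, Finset.sum_add_distrib, ← Finset.mul_sum, laplacian_tens hα hβ,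
    laplacian_tens hβ hα]
  simp only [pairFun, tens, hA, hB]
  ring

/-- The derivative of `α(X) β(Y) + σ β(X) α(Y)` in the direction `s b₀ + t b₁`. -/
theorem directional_pairFun (σ : ℝ) {α β : ℝ → ℝ} (hα : ContDiff ℝ ∞ α) (hβ : ContDiff ℝ ∞ β)
    (s t : ℝ) (x : Plane) :
    ∑ i, (s • b 0 + t • b 1) i * partialDeriv i (pairFun b q σ α β) x
      = s * (tens b q (deriv α) β x + σ * tens b q (deriv β) α x)
        + t * (tens b q α (deriv β) x + σ * tens b q β (deriv α) x) := by
  have h00 := sum_basis_mul (b := b) 0 0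
  have h01 := sum_basis_mul (b := b) 0 1
  have h10 := sum_basis_mul (b := b) 1 0
  have h11 := sum_basis_mul (b := b) 1 1
  simp only [Fin.sum_univ_two] at h00 h01 h10 h11 ⊢
  simp only [partialDeriv_pairFun σ hα hβ, partialDeriv_tens hα hβ, partialDeriv_tens hβ hα,
    PiLp.add_apply, PiLp.smul_apply, smul_eq_mul]
  simp at h00 h01 h10 h11
  linear_combination (tens b q (deriv α) β x + σ * tens b q (deriv β) α x) * (s * h00 + t * h10)
    + (tens b q α (deriv β) x + σ * tens b q β (deriv α) x) * (s * h01 + t * h11)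

end Coordinates

/-! ### Eigenfunctions -/

/-- `α` is bounded by `K` and Lipschitz with constant `K`. -/
def BddLip (K : ℝ) (α : ℝ → ℝ) : Prop :=
  0 ≤ K ∧ (∀ s, |α s| ≤ K) ∧ ∀ s t, |α s - α t| ≤ K * |s - t|

theorem BddLip.mono {K L : ℝ} {α : ℝ → ℝ} (h : BddLip K α) (hKL : K ≤ L) : BddLip L α :=
  ⟨h.1.trans hKL, fun s => (h.2.1 s).trans hKL,
    fun s t => (h.2.2 s t).trans (mul_le_mul_of_nonneg_right hKL (abs_nonneg _))⟩

theorem BddLip.const_mul {K : ℝ} {α : ℝ → ℝ} (h : BddLip K α) (c : ℝ) :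
    BddLip (|c| * K) fun s => c * α s := by
  refine ⟨mul_nonneg (abs_nonneg _) h.1, fun s => ?_, fun s t => ?_⟩
  · rw [abs_mul]
    exact mul_le_mul_of_nonneg_left (h.2.1 s) (abs_nonneg _)
  · rw [← mul_sub, abs_mul, mul_assoc]
    exact mul_le_mul_of_nonneg_left (h.2.2 s t) (abs_nonneg _)

theorem bddLip_sin (w : ℝ) : BddLip (1 + |w|) fun s => Real.sin (w * s) := by
  refine ⟨by positivity, fun s => (Real.abs_sin_le_one _).trans (by simp), fun s t => ?_⟩
  refine (Real.abs_sin_sub_sin_le _ _).trans ?_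
  rw [← mul_sub, abs_mul]
  exact mul_le_mul_of_nonneg_right (by simp) (abs_nonneg _)

theorem bddLip_cos (w : ℝ) : BddLip (1 + |w|) fun s => Real.cos (w * s) := by
  refine ⟨by positivity, fun s => (Real.abs_cos_le_one _).trans (by simp), fun s t => ?_⟩
  refine (Real.abs_cos_sub_cos_le _ _).trans ?_
  rw [← mul_sub, abs_mul]
  exact mul_le_mul_of_nonneg_right (by simp) (abs_nonneg _)

theorem BddLip.mul_le {K : ℝ} {α β : ℝ → ℝ} (hα : BddLip K α) (hβ : BddLip K β) (s : ℝ) {t r : ℝ}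
    (h0 : β r = 0) : |α s * β t| ≤ K ^ 2 * |t - r| := by
  have h := hβ.2.2 t r
  rw [h0, sub_zero] at h
  rw [abs_mul, sq, mul_assoc]
  exact mul_le_mul (hα.2.1 s) h (abs_nonneg _) hα.1

theorem BddLip.skew_le {K : ℝ} {α β : ℝ → ℝ} (hα : BddLip K α) (hβ : BddLip K β) (s t : ℝ) :
    |α s * β t - β s * α t| ≤ 2 * K ^ 2 * |s - t| := by
  have e : α s * β t - β s * α t = (α s - α t) * β t - (β s - β t) * α t := by ring
  have h1 : |(α s - α t) * β t| ≤ K * |s - t| * K := by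
    rw [abs_mul]
    exact mul_le_mul (hα.2.2 s t) (hβ.2.1 t) (abs_nonneg _) (mul_nonneg hα.1 (abs_nonneg _))
  have h2 : |(β s - β t) * α t| ≤ K * |s - t| * K := by
    rw [abs_mul]
    exact mul_le_mul (hβ.2.2 s t) (hα.2.1 t) (abs_nonneg _) (mul_nonneg hα.1 (abs_nonneg _))
  rw [e]
  refine (abs_sub _ _).trans ((add_le_add h1 h2).trans (le_of_eq ?_))
  ring

section Coordinates

variable {b : OrthonormalBasis (Fin 2) ℝ Plane} {q : Plane} {a : ℝ}

/-- If `α` and `β` vanish at `0` and `a`, then `α(X) β(Y) - β(X) α(Y)` vanishes on all three sides: on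
`Y = 0` and `X = a` factor by factor, on `X = Y` by antisymmetry. -/
theorem abs_skew_le_side (hΩ : IsCoordTriangle b q a Ω) {K : ℝ} {α β : ℝ → ℝ}
    (hα : BddLip K α) (hβ : BddLip K β) (hα0 : α 0 = 0) (hβ0 : β 0 = 0) (hαa : α a = 0)
    (hβa : β a = 0) (j : Fin 3) {x : Plane} (hx : x ∈ Ω) :
    |pairFun b q (-1) α β x| ≤ 2 * K ^ 2 * side (triNormal b) (triOffset b q a) j x := by
  obtain ⟨h1, h2, h3⟩ := (hΩ x).1 hx
  simp only [pairFun, tens]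
  set X := coord b q 0 x with hX
  set Y := coord b q 1 x with hY
  have e : α X * β Y + -1 * (β X * α Y) = α X * β Y - β X * α Y := by ring
  rw [e]
  match j with
  | 0 =>
    rw [side_zero]
    have p1 := hα.mul_le hβ X (t := Y) hβ0
    have p2 := hβ.mul_le hα X (t := Y) hα0
    rw [sub_zero, abs_of_pos h1] at p1 p2
    exact (abs_sub _ _).trans (by rw [← hY]; linarith)
  | 1 =>
    rw [side_one]
    have := hα.skew_le hβ X Y
    rwa [abs_of_pos (sub_pos.2 h2)] at this
  | 2 =>
    rw [side_two]
    have p1 := hβ.mul_le hα Y (t := X) hαa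
    have p2 := hα.mul_le hβ Y (t := X) hβa
    rw [abs_sub_comm, abs_of_pos (sub_pos.2 h3), mul_comm] at p1 p2
    exact (abs_sub _ _).trans (by rw [← hX]; linarith)

/-- If `α'` and `β'` vanish at `0` and `a`, then the normal derivative of `α(X) β(Y) + β(X) α(Y)`
vanishes on all three sides: on `Y = 0` and `X = a` factor by factor, and on `X = Y` because the
derivative across the diagonal of a symmetric function is antisymmetric. -/
theorem abs_normalDeriv_le_side (hΩ : IsCoordTriangle b q a Ω) {K : ℝ} {α β : ℝ → ℝ}
    (hα : ContDiff ℝ ∞ α) (hβ : ContDiff ℝ ∞ β)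
    (kα : BddLip K α) (kβ : BddLip K β) (kα' : BddLip K (deriv α)) (kβ' : BddLip K (deriv β))
    (hα0 : deriv α 0 = 0) (hβ0 : deriv β 0 = 0) (hαa : deriv α a = 0) (hβa : deriv β a = 0)
    (j : Fin 3) {x : Plane} (hx : x ∈ Ω) :
    |∑ i, triNormal b j i * partialDeriv i (pairFun b q 1 α β) x|
      ≤ 4 * K ^ 2 * side (triNormal b) (triOffset b q a) j x := by
  obtain ⟨h1, h2, h3⟩ := (hΩ x).1 hx
  have hdir := fun s t => directional_pairFun (b := b) (q := q) 1 hα hβ s t x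
  simp only [tens, one_mul] at hdir
  set X := coord b q 0 x with hX
  set Y := coord b q 1 x with hY
  match j with
  | 0 =>
    have e : triNormal b 0 = (0 : ℝ) • b 0 + (1 : ℝ) • b 1 := by simp [triNormal]
    rw [side_zero, e, hdir, zero_mul, zero_add, one_mul, ← hY]
    have p1 := kα.mul_le kβ' X (t := Y) hβ0
    have p2 := kβ.mul_le kα' X (t := Y) hα0
    rw [sub_zero, abs_of_pos h1] at p1 p2
    refine (abs_add_le _ _).trans ((add_le_add p1 p2).trans ?_)
    nlinarith [mul_nonneg (sq_nonneg K) h1.le]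
  | 1 =>
    have e : triNormal b 1 = (1 : ℝ) • b 0 + (-1 : ℝ) • b 1 := by
      simp [triNormal, sub_eq_add_neg]
    rw [side_one, e, hdir, ← hX, ← hY]
    have e' : 1 * (deriv α X * β Y + deriv β X * α Y) + -1 * (α X * deriv β Y + β X * deriv α Y)
      = (deriv α X * β Y - β X * deriv α Y) + (deriv β X * α Y - α X * deriv β Y) := by ring
    have p1 := kα'.skew_le kβ X Y
    have p2 := kβ'.skew_le kα X Y
    rw [abs_of_pos (sub_pos.2 h2)] at p1 p2
    rw [e']
    exact (abs_add_le _ _).trans ((add_le_add p1 p2).trans (le_of_eq (by ring)))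
  | 2 =>
    have e : triNormal b 2 = (-1 : ℝ) • b 0 + (0 : ℝ) • b 1 := by simp [triNormal]
    rw [side_two, e, hdir, zero_mul, add_zero, ← hX, neg_one_mul, abs_neg]
    have p1 := kβ.mul_le kα' Y (t := X) hαa
    have p2 := kα.mul_le kβ' Y (t := X) hβa
    rw [abs_sub_comm, abs_of_pos (sub_pos.2 h3), mul_comm] at p1 p2
    refine (abs_add_le _ _).trans ((add_le_add p1 p2).trans ?_)
    nlinarith [mul_nonneg (sq_nonneg K) (sub_pos.2 h3).le]

variable (b q) in
/-- The class of `α(X) β(Y) + σ β(X) α(Y)` in `L²(Ω)`. -/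
def pairL2 (hb : Bornology.IsBounded (Ω : Set Plane)) (σ : ℝ) {α β : ℝ → ℝ}
    (hα : ContDiff ℝ ∞ α) (hβ : ContDiff ℝ ∞ β) : L2 Ω :=
  toL2 hb (pairFun b q σ α β) (contDiff_pairFun σ hα hβ).continuous

theorem laplace_toL2_add_smul {f : Plane → ℝ} (hb : Bornology.IsBounded (Ω : Set Plane))
    (hf : ContDiff ℝ ∞ f) {μ : ℝ} (hΔ : ∀ x, ∑ i, partialDeriv i (partialDeriv i f) x = -μ * f x) :
    (∑ i, toL2 hb (partialDeriv i (partialDeriv i f))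
        (contDiff_partialDeriv (contDiff_partialDeriv hf i) i).continuous)
      + μ • toL2 hb f hf.continuous = 0 := by
  refine Lp.ext ?_
  have h0 := coeFn_toL2 hb hf.continuous
  have h1 := fun i => coeFn_toL2 hb (contDiff_partialDeriv (contDiff_partialDeriv hf i) i).continuous
  rw [Fin.sum_univ_two]
  filter_upwards [h0, h1 0, h1 1, Lp.coeFn_add (toL2 hb (partialDeriv 0 (partialDeriv 0 f))
      (contDiff_partialDeriv (contDiff_partialDeriv hf 0) 0).continuous
      + toL2 hb (partialDeriv 1 (partialDeriv 1 f))
      (contDiff_partialDeriv (contDiff_partialDeriv hf 1) 1).continuous)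
      (μ • toL2 hb f hf.continuous),
    Lp.coeFn_add (toL2 hb (partialDeriv 0 (partialDeriv 0 f))
      (contDiff_partialDeriv (contDiff_partialDeriv hf 0) 0).continuous)
      (toL2 hb (partialDeriv 1 (partialDeriv 1 f))
      (contDiff_partialDeriv (contDiff_partialDeriv hf 1) 1).continuous),
    Lp.coeFn_smul μ (toL2 hb f hf.continuous),
    Lp.coeFn_zero ℝ 2 ((volume : Measure Plane).restrict (Ω : Set Plane))] with x k0 k1 k2 k3 k4 k5 k6
  have := hΔ x
  rw [Fin.sum_univ_two] at this
  rw [k3, Pi.add_apply, k4, Pi.add_apply, k1, k2, k5, Pi.smul_apply, k0, k6, this, smul_eq_mul,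
    Pi.zero_apply]
  ring

theorem pairL2_mem_dirichletEigenspace (hΩ : IsCoordTriangle b q a Ω)
    (hb : Bornology.IsBounded (Ω : Set Plane)) {K : ℝ} {α β : ℝ → ℝ}
    (hα : ContDiff ℝ ∞ α) (hβ : ContDiff ℝ ∞ β) {A B : ℝ}
    (hA : ∀ s, deriv (deriv α) s = -A * α s) (hB : ∀ s, deriv (deriv β) s = -B * β s)
    (kα : BddLip K α) (kβ : BddLip K β) (hα0 : α 0 = 0) (hβ0 : β 0 = 0) (hαa : α a = 0)
    (hβa : β a = 0) : pairL2 b q hb (-1) hα hβ ∈ dirichletEigenspace Ω (A + B) := by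
  have hf := contDiff_pairFun (b := b) (q := q) (-1) hα hβ
  refine ⟨fun i => toL2 hb _ (contDiff_partialDeriv hf i).continuous,
    fun i j => toL2 hb _ (contDiff_partialDeriv (contDiff_partialDeriv hf i) j).continuous,
    ⟨fun i => isWeakPartial_toL2 hb hf i,
      fun i j => isWeakPartial_toL2 hb (contDiff_partialDeriv hf i) j⟩,
    toL2_mem_sobolevZeroGraph hΩ.mem_iff_side hb hf (D := 2 * K ^ 2)
      fun j x hx => abs_skew_le_side hΩ kα kβ hα0 hβ0 hαa hβa j hx, ?_⟩
  exact laplace_toL2_add_smul hb hf (laplacian_pairFun (-1) hα hβ hA hB)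

theorem pairL2_mem_neumannEigenspace (hΩ : IsCoordTriangle b q a Ω)
    (hb : Bornology.IsBounded (Ω : Set Plane)) {K : ℝ} {α β : ℝ → ℝ}
    (hα : ContDiff ℝ ∞ α) (hβ : ContDiff ℝ ∞ β) {A B : ℝ}
    (hA : ∀ s, deriv (deriv α) s = -A * α s) (hB : ∀ s, deriv (deriv β) s = -B * β s)
    (kα : BddLip K α) (kβ : BddLip K β) (kα' : BddLip K (deriv α)) (kβ' : BddLip K (deriv β))
    (hα0 : deriv α 0 = 0) (hβ0 : deriv β 0 = 0) (hαa : deriv α a = 0) (hβa : deriv β a = 0) :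
    pairL2 b q hb 1 hα hβ ∈ neumannEigenspace Ω (A + B) := by
  have hf := contDiff_pairFun (b := b) (q := q) 1 hα hβ
  have hdf := fun i => contDiff_partialDeriv hf i
  refine ⟨fun i => toL2 hb _ (hdf i).continuous,
    fun i j => toL2 hb _ (contDiff_partialDeriv (hdf i) j).continuous,
    ⟨fun i => isWeakPartial_toL2 hb hf i, fun i j => isWeakPartial_toL2 hb (hdf i) j⟩,
    fun v k hv => ?_, laplace_toL2_add_smul hb hf (laplacian_pairFun 1 hα hβ hA hB)⟩
  have h := integral_grad_add_integral_div_eq_zero hΩ.mem_iff_side hb hdf (D := 4 * K ^ 2)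
    (fun j x hx => abs_normalDeriv_le_side hΩ hα hβ kα kβ kα' kβ' hα0 hβ0 hαa hβa j hx) hv
  simp only [Finset.mul_sum] at h
  rw [integral_finsetSum _ fun i _ => integrable_mul_continuous hb
    (contDiff_partialDeriv (hdf i) i).continuous v] at h
  rw [sum_inner]
  simp only [inner_toL2]
  exact h

theorem deriv_sin_mul (w : ℝ) :
    deriv (fun s => Real.sin (w * s)) = fun s => w * Real.cos (w * s) := by
  ext s
  have := ((Real.hasDerivAt_sin (w * s)).comp s ((hasDerivAt_id s).const_mul w)).deriv
  simp only [mul_one, mul_comm _ w] at this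
  exact this

theorem deriv_cos_mul (w : ℝ) :
    deriv (fun s => Real.cos (w * s)) = fun s => -w * Real.sin (w * s) := by
  ext s
  have := ((Real.hasDerivAt_cos (w * s)).comp s ((hasDerivAt_id s).const_mul w)).deriv
  simp only [mul_one] at this
  refine this.trans ?_
  ring

theorem deriv_deriv_sin_mul (w s : ℝ) :
    deriv (deriv fun s => Real.sin (w * s)) s = -w ^ 2 * Real.sin (w * s) := by
  rw [deriv_sin_mul, deriv_const_mul_field, deriv_cos_mul]
  ring

theorem deriv_deriv_cos_mul (w s : ℝ) :
    deriv (deriv fun s => Real.cos (w * s)) s = -w ^ 2 * Real.cos (w * s) := by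
  rw [deriv_cos_mul, deriv_const_mul_field, deriv_sin_mul]
  ring

theorem contDiff_sin_mul (w : ℝ) : ContDiff ℝ ∞ fun s => Real.sin (w * s) :=
  Real.contDiff_sin.comp (contDiff_const.mul contDiff_id)

theorem contDiff_cos_mul (w : ℝ) : ContDiff ℝ ∞ fun s => Real.cos (w * s) :=
  Real.contDiff_cos.comp (contDiff_const.mul contDiff_id)

theorem sinPair_mem_dirichletEigenspace (hΩ : IsCoordTriangle b q a Ω)
    (hb : Bornology.IsBounded (Ω : Set Plane)) {w w' : ℝ} (h : Real.sin (w * a) = 0)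
    (h' : Real.sin (w' * a) = 0) :
    pairL2 b q hb (-1) (contDiff_sin_mul w) (contDiff_sin_mul w')
      ∈ dirichletEigenspace Ω (w ^ 2 + w' ^ 2) :=
  pairL2_mem_dirichletEigenspace hΩ hb _ _ (deriv_deriv_sin_mul w) (deriv_deriv_sin_mul w')
    ((bddLip_sin w).mono (le_max_left _ (1 + |w'|))) ((bddLip_sin w').mono (le_max_right _ _))
    (by simp) (by simp) h h'

theorem cosPair_mem_neumannEigenspace (hΩ : IsCoordTriangle b q a Ω)
    (hb : Bornology.IsBounded (Ω : Set Plane)) {w w' : ℝ} (h : Real.sin (w * a) = 0)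
    (h' : Real.sin (w' * a) = 0) :
    pairL2 b q hb 1 (contDiff_cos_mul w) (contDiff_cos_mul w')
      ∈ neumannEigenspace Ω (w ^ 2 + w' ^ 2) := by
  have k : ∀ w, BddLip (|(-w)| * (1 + |w|)) (deriv fun s => Real.cos (w * s)) := fun w => by
    rw [deriv_cos_mul]
    exact (bddLip_sin w).const_mul (-w)
  refine pairL2_mem_neumannEigenspace hΩ hb _ _ (deriv_deriv_cos_mul w) (deriv_deriv_cos_mul w')
    (K := max (max (1 + |w|) (1 + |w'|)) (max (|(-w)| * (1 + |w|)) (|(-w')| * (1 + |w'|))))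
    ((bddLip_cos w).mono (by simp)) ((bddLip_cos w').mono (by simp))
    ((k w).mono (by simp)) ((k w').mono (by simp)) ?_ ?_ ?_ ?_ <;>
  simp [deriv_cos_mul, h, h']

end Coordinates

/-! ### Inner products of eigenfunctions -/

section Coordinates

variable {b : OrthonormalBasis (Fin 2) ℝ Plane} {q : Plane} {a : ℝ}

variable (b q) in
/-- The coordinates `(X, Y)` with respect to the frame `b` at `q`. -/
def coordMap (x : Plane) : ℝ × ℝ := (coord b q 0 x, coord b q 1 x)

theorem measurePreserving_coordMap : MeasurePreserving (coordMap b q) := by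
  have h := (volume_preserving_finTwoArrow ℝ).comp
    ((PiLp.volume_preserving_ofLp (Fin 2)).comp
      (b.measurePreserving_repr.comp (measurePreserving_sub_right volume q)))
  have e : coordMap b q = MeasurableEquiv.finTwoArrow ∘ WithLp.ofLp ∘ b.repr ∘ fun x => x - q := by
    funext x
    simp only [coordMap, coord, MeasurableEquiv.finTwoArrow, Function.comp_apply,
      ← b.repr_apply_apply]
    rfl
  rw [e]
  exact h

theorem measurableEmbedding_coordMap : MeasurableEmbedding (coordMap b q) := by
  refine Continuous.measurableEmbedding
    ((contDiff_coord 0).continuous.prodMk (contDiff_coord 1).continuous) fun x y h => ?_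
  simp only [coordMap, Prod.mk.injEq] at h
  have : x - q = y - q := by
    refine b.repr.injective ?_
    ext i
    fin_cases i
    · exact (b.repr_apply_apply _ _).trans (h.1.trans (b.repr_apply_apply _ _).symm)
    · exact (b.repr_apply_apply _ _).trans (h.2.trans (b.repr_apply_apply _ _).symm)
  exact sub_left_injective this

variable (a) in
/-- The triangle `0 < Y < X < a` in the coordinate plane. -/
def triangle : Set (ℝ × ℝ) := {p | 0 < p.2 ∧ p.2 < p.1 ∧ p.1 < a}

theorem measurableSet_triangle : MeasurableSet (triangle a) :=
  ((isOpen_lt continuous_const continuous_snd).inter ((isOpen_lt continuous_snd continuous_fst).inter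
    (isOpen_lt continuous_fst continuous_const))).measurableSet

theorem setIntegral_coordMap (hΩ : IsCoordTriangle b q a Ω) (F : ℝ × ℝ → ℝ) :
    ∫ x in (Ω : Set Plane), F (coordMap b q x) = ∫ p in triangle a, F p := by
  have : (Ω : Set Plane) = coordMap b q ⁻¹' triangle a := by
    ext x
    exact hΩ x
  rw [this]
  exact measurePreserving_coordMap.setIntegral_preimage_emb measurableEmbedding_coordMap F _

/-- Half the integral of a symmetric function over the square is its integral over the triangle. -/
theorem two_mul_setIntegral_triangle {F : ℝ × ℝ → ℝ} (hF : Continuous F)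
    (hsymm : ∀ p, F p.swap = F p) :
    2 * ∫ p in triangle a, F p = ∫ p in Set.Ioo 0 a ×ˢ Set.Ioo 0 a, F p := by
  have hint : IntegrableOn F (Set.Ioo 0 a ×ˢ Set.Ioo 0 a) :=
    (hF.continuousOn.integrableOn_compact (isCompact_Icc.prod isCompact_Icc)).mono_set
      (Set.prod_mono Set.Ioo_subset_Icc_self Set.Ioo_subset_Icc_self)
  have hsub : triangle a ⊆ Set.Ioo 0 a ×ˢ Set.Ioo 0 a := fun p ⟨h1, h2, h3⟩ =>
    ⟨⟨h1.trans h2, h3⟩, h1, h2.trans h3⟩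
  have hsub' : Prod.swap ⁻¹' triangle a ⊆ Set.Ioo 0 a ×ˢ Set.Ioo 0 a := fun p ⟨h1, h2, h3⟩ =>
    ⟨⟨h1, h2.trans h3⟩, h1.trans h2, h3⟩
  have hm' : MeasurableSet (Prod.swap ⁻¹' triangle a : Set (ℝ × ℝ)) :=
    measurable_swap measurableSet_triangle
  have hdiag : volume {p : ℝ × ℝ | p.1 = p.2} = 0 := by
    rw [Measure.volume_eq_prod,
      Measure.measure_prod_null (measurableSet_eq_fun measurable_fst measurable_snd)]
    refine ae_of_all _ fun x => ?_
    have : Prod.mk x ⁻¹' {p : ℝ × ℝ | p.1 = p.2} = {x} := by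
      ext y; simp [eq_comm]
    simp [this]
  have hae : (Set.Ioo 0 a ×ˢ Set.Ioo 0 a : Set (ℝ × ℝ))
      =ᵐ[volume] (triangle a ∪ Prod.swap ⁻¹' triangle a : Set (ℝ × ℝ)) := by
    have hnd : ∀ᵐ p : ℝ × ℝ, p.1 ≠ p.2 := by
      rw [ae_iff]; simpa using hdiag
    filter_upwards [hnd] with p hp
    refine propext ⟨fun ⟨⟨h1, h2⟩, h3, h4⟩ => ?_, fun h => ?_⟩
    · rcases lt_or_gt_of_ne hp with h | h
      · exact Or.inr ⟨h1, h, h4⟩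
      · exact Or.inl ⟨h3, h, h2⟩
    · rcases h with h | h
      · exact hsub h
      · exact hsub' h
  have hdisj : Disjoint (triangle a) (Prod.swap ⁻¹' triangle a) :=
    Set.disjoint_left.2 fun p h1 h2 => lt_asymm h1.2.1 h2.2.1
  have hswap : ∫ p in Prod.swap ⁻¹' triangle a, F p = ∫ p in triangle a, F p := by
    have := (Measure.measurePreserving_swap (μ := (volume : Measure ℝ))
      (ν := (volume : Measure ℝ))).setIntegral_preimage_emb
        MeasurableEquiv.prodComm.measurableEmbedding F (triangle a)
    simp only [hsymm] at this
    exact this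
  rw [setIntegral_congr_set hae, setIntegral_union hdisj hm' (hint.mono_set hsub)
    (hint.mono_set hsub'), hswap, two_mul]

/-- The product of two symmetrised, or of two antisymmetrised, functions is symmetric, so that the inner
product over the triangle is half of the integral over the square, where the variables separate. -/
theorem inner_pairL2 (hΩ : IsCoordTriangle b q a Ω)
    (hb : Bornology.IsBounded (Ω : Set Plane)) {σ : ℝ} (hσ : σ ^ 2 = 1) {α β γ δ : ℝ → ℝ}
    (hα : ContDiff ℝ ∞ α) (hβ : ContDiff ℝ ∞ β) (hγ : ContDiff ℝ ∞ γ) (hδ : ContDiff ℝ ∞ δ) :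
    inner ℝ (pairL2 b q hb σ hα hβ) (pairL2 b q hb σ hγ hδ)
      = (∫ s in Set.Ioo 0 a, α s * γ s) * (∫ s in Set.Ioo 0 a, β s * δ s)
        + σ * ((∫ s in Set.Ioo 0 a, α s * δ s) * (∫ s in Set.Ioo 0 a, β s * γ s)) := by
  have cα := hα.continuous
  have cβ := hβ.continuous
  have cγ := hγ.continuous
  have cδ := hδ.continuous
  set F : ℝ × ℝ → ℝ := fun p => (γ p.1 * δ p.2 + σ * (δ p.1 * γ p.2))
    * (α p.1 * β p.2 + σ * (β p.1 * α p.2)) with hF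
  have hFc : Continuous F := by fun_prop
  -- exchanging the variables multiplies each factor by `σ`
  have hsymm : ∀ p, F p.swap = F p := by
    rintro ⟨x, y⟩
    simp only [hF, Prod.swap]
    linear_combination -((γ y * δ x) * (α y * β x) - (δ y * γ x) * (β y * α x)) * hσ
  have h1 : inner ℝ (pairL2 b q hb σ hα hβ) (pairL2 b q hb σ hγ hδ) = ∫ p in triangle a, F p := by
    rw [pairL2, inner_toL2, ← setIntegral_coordMap hΩ]
    refine integral_congr_ae ?_
    filter_upwards [coeFn_toL2 hb (contDiff_pairFun (b := b) (q := q) σ hγ hδ).continuous] with x hx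
    rw [pairL2, hx]
    rfl
  have h2 := two_mul_setIntegral_triangle (a := a) hFc hsymm
  have hprod : ∀ f g : ℝ → ℝ, Continuous f → Continuous g →
      Integrable (fun p : ℝ × ℝ => f p.1 * g p.2) (volume.restrict (Set.Ioo 0 a ×ˢ Set.Ioo 0 a)) :=
    fun f g hf hg =>
      ((hf.comp continuous_fst).mul (hg.comp continuous_snd)).continuousOn.integrableOn_compact
        (isCompact_Icc.prod isCompact_Icc) |>.mono_set
      (Set.prod_mono Set.Ioo_subset_Icc_self Set.Ioo_subset_Icc_self)
  have h3 : ∫ p in Set.Ioo 0 a ×ˢ Set.Ioo 0 a, F p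
      = 2 * ((∫ s in Set.Ioo 0 a, α s * γ s) * (∫ s in Set.Ioo 0 a, β s * δ s)
        + σ * ((∫ s in Set.Ioo 0 a, α s * δ s) * (∫ s in Set.Ioo 0 a, β s * γ s))) := by
    have e : F = fun p => (α p.1 * γ p.1) * (β p.2 * δ p.2)
        + (σ * ((α p.1 * δ p.1) * (β p.2 * γ p.2)) + (σ * ((β p.1 * γ p.1) * (α p.2 * δ p.2))
        + (β p.1 * δ p.1) * (α p.2 * γ p.2))) := by
      ext p
      simp only [hF]
      linear_combination (β p.1 * δ p.1) * (α p.2 * γ p.2) * hσ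
    have i1 : Integrable (fun p : ℝ × ℝ => (α p.1 * γ p.1) * (β p.2 * δ p.2)) _ :=
      hprod _ _ (cα.mul cγ) (cβ.mul cδ)
    have i2 : Integrable (fun p : ℝ × ℝ => σ * ((α p.1 * δ p.1) * (β p.2 * γ p.2))) _ :=
      (hprod _ _ (cα.mul cδ) (cβ.mul cγ)).const_mul σ
    have i3 : Integrable (fun p : ℝ × ℝ => σ * ((β p.1 * γ p.1) * (α p.2 * δ p.2))) _ :=
      (hprod _ _ (cβ.mul cγ) (cα.mul cδ)).const_mul σ
    have i4 : Integrable (fun p : ℝ × ℝ => (β p.1 * δ p.1) * (α p.2 * γ p.2)) _ :=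
      hprod _ _ (cβ.mul cδ) (cα.mul cγ)
    have i34 : Integrable (fun p : ℝ × ℝ => σ * ((β p.1 * γ p.1) * (α p.2 * δ p.2))
        + (β p.1 * δ p.1) * (α p.2 * γ p.2)) _ := i3.add i4
    have i234 : Integrable (fun p : ℝ × ℝ => σ * ((α p.1 * δ p.1) * (β p.2 * γ p.2))
        + (σ * ((β p.1 * γ p.1) * (α p.2 * δ p.2)) + (β p.1 * δ p.1) * (α p.2 * γ p.2))) _ :=
      i2.add i34
    rw [e, integral_add i1 i234, integral_add i2 i34, integral_add i3 i4,
      integral_const_mul, integral_const_mul, Measure.volume_eq_prod,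
      setIntegral_prod_mul (fun s => α s * γ s) (fun s => β s * δ s),
      setIntegral_prod_mul (fun s => α s * δ s) (fun s => β s * γ s),
      setIntegral_prod_mul (fun s => β s * γ s) (fun s => α s * δ s),
      setIntegral_prod_mul (fun s => β s * δ s) (fun s => α s * γ s)]
    ring
  rw [h1]
  linarith

end Coordinates

/-! ### Trigonometric integrals -/

theorem integral_cos_int {a : ℝ} (ha : 0 < a) (j : ℤ) :
    ∫ s in Set.Ioo 0 a, Real.cos (Real.pi / a * j * s) = if j = 0 then a else 0 := by
  rw [← integral_Ioc_eq_integral_Ioo, ← intervalIntegral.integral_of_le ha.le]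
  split_ifs with h
  · simp [h]
  · have hj : (j : ℝ) ≠ 0 := by exact_mod_cast h
    have hc : Real.pi / a * j ≠ 0 := mul_ne_zero (by positivity) hj
    rw [intervalIntegral.integral_comp_mul_left (fun s => Real.cos s) hc, integral_cos]
    have : Real.pi / a * j * a = j * Real.pi := by field_simp
    simp [this]

theorem integrable_cos_Ioo (a w : ℝ) :
    Integrable (fun s => Real.cos (w * s)) (volume.restrict (Set.Ioo 0 a)) :=
  ((Real.continuous_cos.comp (continuous_const.mul continuous_id)).integrableOn_Icc).mono_set
    Set.Ioo_subset_Icc_self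

theorem integral_sin_mul_sin {a : ℝ} (ha : 0 < a) {m n : ℕ} (hm : 1 ≤ m) :
    ∫ s in Set.Ioo 0 a, Real.sin (Real.pi / a * m * s) * Real.sin (Real.pi / a * n * s)
      = if m = n then a / 2 else 0 := by
  have e : ∀ s, Real.sin (Real.pi / a * m * s) * Real.sin (Real.pi / a * n * s)
      = 1 / 2 * (Real.cos (Real.pi / a * ((m - n : ℤ) : ℝ) * s)
        - Real.cos (Real.pi / a * ((m + n : ℤ) : ℝ) * s)) := fun s => by
    have e1 : Real.pi / a * ((m - n : ℤ) : ℝ) * s = Real.pi / a * m * s - Real.pi / a * n * s := by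
      push_cast; ring
    have e2 : Real.pi / a * ((m + n : ℤ) : ℝ) * s = Real.pi / a * m * s + Real.pi / a * n * s := by
      push_cast; ring
    rw [e1, e2, Real.cos_sub, Real.cos_add]
    ring
  simp only [e]
  rw [integral_const_mul, integral_sub (integrable_cos_Ioo _ _) (integrable_cos_Ioo _ _),
    integral_cos_int ha, integral_cos_int ha, if_neg (by omega : ¬ ((m : ℤ) + n = 0))]
  by_cases h : m = n
  · simp [h]; ring
  · rw [if_neg (by omega), if_neg h]; ring

theorem integral_cos_mul_cos {a : ℝ} (ha : 0 < a) (m n : ℕ) :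
    ∫ s in Set.Ioo 0 a, Real.cos (Real.pi / a * m * s) * Real.cos (Real.pi / a * n * s)
      = if m = n then (if m = 0 then a else a / 2) else 0 := by
  have e : ∀ s, Real.cos (Real.pi / a * m * s) * Real.cos (Real.pi / a * n * s)
      = 1 / 2 * (Real.cos (Real.pi / a * ((m - n : ℤ) : ℝ) * s)
        + Real.cos (Real.pi / a * ((m + n : ℤ) : ℝ) * s)) := fun s => by
    have e1 : Real.pi / a * ((m - n : ℤ) : ℝ) * s = Real.pi / a * m * s - Real.pi / a * n * s := by
      push_cast; ring
    have e2 : Real.pi / a * ((m + n : ℤ) : ℝ) * s = Real.pi / a * m * s + Real.pi / a * n * s := by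
      push_cast; ring
    rw [e1, e2, Real.cos_sub, Real.cos_add]
    ring
  simp only [e]
  rw [integral_const_mul, integral_add (integrable_cos_Ioo _ _) (integrable_cos_Ioo _ _),
    integral_cos_int ha, integral_cos_int ha]
  by_cases h : m = n
  · subst h
    rcases Nat.eq_zero_or_pos m with h0 | h0
    · simp [h0]; ring
    · rw [if_pos (by omega), if_neg (by omega), if_pos rfl, if_neg (by omega)]; ring
  · rw [if_neg (by omega), if_neg (by omega), if_neg h]; ring

/-! ### Completeness of the eigenfunctions -/

/-- The functional `G ↦ ∫_Ω u G` on continuous functions. -/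
def pairing (hb : Bornology.IsBounded (Ω : Set Plane)) (u : L2 Ω) : C(Plane, ℝ) →ₗ[ℝ] ℝ where
  toFun G := ∫ x in (Ω : Set Plane), u x * G x
  map_add' G H := by
    rw [← integral_add (integrable_mul_continuous hb G.continuous u)
      (integrable_mul_continuous hb H.continuous u)]
    simp [mul_add]
  map_smul' r G := by
    rw [RingHom.id_apply, smul_eq_mul, ← integral_const_mul]
    simp [mul_left_comm]

section Coordinates

variable (b : OrthonormalBasis (Fin 2) ℝ Plane) (q : Plane) (a : ℝ)

/-- `cos(mπX/a) cos(nπY/a) + cos(nπX/a) cos(mπY/a)` for integers `m`, `n`. -/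
def symCos (m n : ℤ) : C(Plane, ℝ) :=
  ⟨pairFun b q 1 (fun s => Real.cos (Real.pi / a * m * s)) (fun s => Real.cos (Real.pi / a * n * s)),
    (contDiff_pairFun 1 (contDiff_cos_mul _) (contDiff_cos_mul _)).continuous⟩

/-- `sin(mπX/a) sin(nπY/a) - sin(nπX/a) sin(mπY/a)` for integers `m`, `n`. -/
def skewSin (m n : ℤ) : C(Plane, ℝ) :=
  ⟨pairFun b q (-1) (fun s => Real.sin (Real.pi / a * m * s))
      (fun s => Real.sin (Real.pi / a * n * s)),
    (contDiff_pairFun (-1) (contDiff_sin_mul _) (contDiff_sin_mul _)).continuous⟩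

theorem symCos_apply (m n : ℤ) (x : Plane) : symCos b q a m n x
    = Real.cos (Real.pi / a * m * coord b q 0 x) * Real.cos (Real.pi / a * n * coord b q 1 x)
      + Real.cos (Real.pi / a * n * coord b q 0 x) * Real.cos (Real.pi / a * m * coord b q 1 x) := by
  simp [symCos, pairFun, tens]

theorem skewSin_apply (m n : ℤ) (x : Plane) : skewSin b q a m n x
    = Real.sin (Real.pi / a * m * coord b q 0 x) * Real.sin (Real.pi / a * n * coord b q 1 x)
      - Real.sin (Real.pi / a * n * coord b q 0 x) * Real.sin (Real.pi / a * m * coord b q 1 x) := by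
  simp [skewSin, pairFun, tens, sub_eq_add_neg]

theorem symCos_mul (m n k l : ℤ) : symCos b q a m n * symCos b q a k l = (1 / 4 : ℝ) •
    (symCos b q a (m + k) (n + l) + symCos b q a (m + k) (n - l) + symCos b q a (m - k) (n + l)
      + symCos b q a (m - k) (n - l) + symCos b q a (m + l) (n + k) + symCos b q a (m + l) (n - k)
      + symCos b q a (m - l) (n + k) + symCos b q a (m - l) (n - k)) := by
  ext x
  simp only [ContinuousMap.mul_apply, ContinuousMap.smul_apply, ContinuousMap.add_apply,
    symCos_apply, Int.cast_add, Int.cast_sub, mul_add, mul_sub, add_mul, sub_mul, Real.cos_add,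
    Real.cos_sub, smul_eq_mul]
  ring

/-- The products of an antisymmetrised product of sines with the symmetrised products of cosines stay in
the span of the antisymmetrised products of sines; this reduces completeness of the Dirichlet
eigenfunctions to that of the Neumann eigenfunctions. -/
theorem skewSin_mul_symCos (m n k l : ℤ) : skewSin b q a m n * symCos b q a k l = (1 / 4 : ℝ) •
    (skewSin b q a (m + k) (n + l) + skewSin b q a (m + k) (n - l) + skewSin b q a (m - k) (n + l)
      + skewSin b q a (m - k) (n - l) + skewSin b q a (m + l) (n + k)
      + skewSin b q a (m + l) (n - k) + skewSin b q a (m - l) (n + k)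
      + skewSin b q a (m - l) (n - k)) := by
  ext x
  simp only [ContinuousMap.mul_apply, ContinuousMap.smul_apply, ContinuousMap.add_apply,
    symCos_apply, skewSin_apply, Int.cast_add, Int.cast_sub, mul_add, mul_sub, add_mul, sub_mul,
    Real.sin_add, Real.sin_sub, smul_eq_mul]
  ring

/-- The algebra spanned by the symmetric products of cosines. -/
def symCosAlgebra : Subalgebra ℝ C(Plane, ℝ) :=
  (Submodule.span ℝ (Set.range fun p : ℤ × ℤ => symCos b q a p.1 p.2)).toSubalgebra
    (by
      have h : (1 : C(Plane, ℝ)) = (1 / 2 : ℝ) • symCos b q a 0 0 := by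
        ext x
        simp [symCos_apply]
        norm_num
      rw [h]
      exact Submodule.smul_mem _ _ (Submodule.subset_span ⟨(0, 0), rfl⟩))
    (fun x y hx hy => by
      have hxy := Submodule.mul_mem_mul hx hy
      rw [Submodule.span_mul_span] at hxy
      refine Submodule.span_le.2 ?_ hxy
      rintro _ ⟨_, ⟨⟨m, n⟩, rfl⟩, _, ⟨⟨k, l⟩, rfl⟩, rfl⟩
      have hmem : ∀ i j, symCos b q a i j
          ∈ Submodule.span ℝ (Set.range fun p : ℤ × ℤ => symCos b q a p.1 p.2) :=
        fun i j => Submodule.subset_span ⟨(i, j), rfl⟩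
      simp only [symCos_mul, SetLike.mem_coe]
      refine Submodule.smul_mem _ _ ?_
      repeat' apply Submodule.add_mem
      all_goals exact hmem _ _)

theorem symCos_mem (m n : ℤ) : symCos b q a m n ∈ symCosAlgebra b q a :=
  Submodule.subset_span ⟨(m, n), rfl⟩

/-- The closed triangle `0 ≤ Y ≤ X ≤ a`. -/
def closedTriangle : Set Plane :=
  {x | 0 ≤ coord b q 1 x ∧ coord b q 1 x ≤ coord b q 0 x ∧ coord b q 0 x ≤ a}

variable {b q a}

theorem isCompact_closedTriangle : IsCompact (closedTriangle b q a) := by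
  have c0 := (contDiff_coord (b := b) (q := q) 0).continuous
  have c1 := (contDiff_coord (b := b) (q := q) 1).continuous
  refine Metric.isCompact_of_isClosed_isBounded
    ((isClosed_le continuous_const c1).inter ((isClosed_le c1 c0).inter
      (isClosed_le c0 continuous_const)))
    ((Metric.isBounded_closedBall (x := q) (r := √(2 * a ^ 2))).subset fun x hx => ?_)
  obtain ⟨h1, h2, h3⟩ := hx
  rw [Metric.mem_closedBall, dist_eq_norm]
  refine Real.le_sqrt_of_sq_le ?_
  rw [norm_sub_sq_eq (b := b)]
  nlinarith

theorem injective_coordMap : Function.Injective (coordMap b q) :=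
  measurableEmbedding_coordMap.injective

/-- On the closed triangle `cos(πX/a) ≤ cos(πY/a)`, so that the sum and the product of these two
numbers determine the point. -/
theorem eq_of_symCos_eq (ha : 0 < a) {x y : Plane} (hx : x ∈ closedTriangle b q a)
    (hy : y ∈ closedTriangle b q a) (h1 : symCos b q a 0 1 x = symCos b q a 0 1 y)
    (h2 : symCos b q a 1 1 x = symCos b q a 1 1 y) : x = y := by
  have hscale : ∀ s, 0 ≤ s → s ≤ a → Real.pi / a * s ∈ Set.Icc 0 Real.pi := fun s h0 ha' => by
    refine ⟨by positivity, ?_⟩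
    calc Real.pi / a * s ≤ Real.pi / a * a := by gcongr
      _ = Real.pi := by field_simp
  obtain ⟨hx1, hx2, hx3⟩ := hx
  obtain ⟨hy1, hy2, hy3⟩ := hy
  have X1 := hscale _ (hx1.trans hx2) hx3
  have X2 := hscale _ hx1 (hx2.trans hx3)
  have Y1 := hscale _ (hy1.trans hy2) hy3
  have Y2 := hscale _ hy1 (hy2.trans hy3)
  have lx := Real.strictAntiOn_cos.antitoneOn X2 X1 (mul_le_mul_of_nonneg_left hx2 (by positivity))
  have ly := Real.strictAntiOn_cos.antitoneOn Y2 Y1 (mul_le_mul_of_nonneg_left hy2 (by positivity))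
  simp only [symCos_apply, Int.cast_zero, Int.cast_one, mul_zero, zero_mul, Real.cos_zero, mul_one,
    one_mul] at h1 h2
  have hc : Real.cos (Real.pi / a * coord b q 0 x) = Real.cos (Real.pi / a * coord b q 0 y) ∧
      Real.cos (Real.pi / a * coord b q 1 x) = Real.cos (Real.pi / a * coord b q 1 y) := by
    generalize Real.cos (Real.pi / a * coord b q 0 x) = c at *
    generalize Real.cos (Real.pi / a * coord b q 1 x) = d at *
    generalize Real.cos (Real.pi / a * coord b q 0 y) = c' at *
    generalize Real.cos (Real.pi / a * coord b q 1 y) = d' at *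
    -- `c` is a root of the quadratic polynomial with the roots `c'` and `d'`
    have hp : (c - c') * (c - d') = 0 := by
      linear_combination c * h1 - (1 / 2) * h2
    rcases mul_eq_zero.1 hp with h | h
    · constructor <;> linarith
    · constructor <;> linarith
  have hne : Real.pi / a ≠ 0 := by positivity
  refine injective_coordMap (b := b) (q := q) (Prod.ext ?_ ?_)
  · exact mul_left_cancel₀ hne (Real.injOn_cos X1 Y1 hc.1)
  · exact mul_left_cancel₀ hne (Real.injOn_cos X2 Y2 hc.2)

theorem exists_symCosAlgebra_near (ha : 0 < a) {g : Plane → ℝ} (hg : Continuous g) {ε : ℝ}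
    (hε : 0 < ε) : ∃ G ∈ symCosAlgebra b q a, ∀ x ∈ closedTriangle b q a, |G x - g x| < ε := by
  have : CompactSpace (closedTriangle b q a) := isCompact_iff_compactSpace.1 isCompact_closedTriangle
  let r : C(closedTriangle b q a, Plane) := ⟨Subtype.val, continuous_subtype_val⟩
  let A := (symCosAlgebra b q a).map (ContinuousMap.compRightAlgHom ℝ ℝ r)
  have hsep : A.SeparatesPoints := by
    intro x y hxy
    by_contra! hcon
    have h : ∀ m n, symCos b q a m n x = symCos b q a m n y := fun m n =>
      hcon _ ⟨ContinuousMap.compRightAlgHom ℝ ℝ r (symCos b q a m n),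
        ⟨_, symCos_mem b q a m n, rfl⟩, rfl⟩
    exact hxy (Subtype.ext (eq_of_symCos_eq ha x.2 y.2 (h 0 1) (h 1 1)))
  obtain ⟨⟨_, ⟨G, hG, rfl⟩⟩, h⟩ :=
    ContinuousMap.exists_mem_subalgebra_near_continuous_of_separatesPoints A hsep
      (fun x => g x) (hg.comp continuous_subtype_val) ε hε
  exact ⟨G, hG, fun x hx => h ⟨x, hx⟩⟩

/-- A function in `L²(Ω)` vanishes if, with a nowhere vanishing weight, it is orthogonal to all
symmetric products of cosines. -/
theorem eq_zero_of_pairing_symCos (ha : 0 < a) (hΩ : IsCoordTriangle b q a Ω)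
    (hb : Bornology.IsBounded (Ω : Set Plane)) {u : L2 Ω} {W : C(Plane, ℝ)}
    (hW : ∀ x ∈ Ω, W x ≠ 0) (h : ∀ m n, pairing hb u (W * symCos b q a m n) = 0) : u = 0 := by
  have hΩm : MeasurableSet (Ω : Set Plane) := Ω.isOpen.measurableSet
  have hint : ∀ G : C(Plane, ℝ),
      Integrable (fun x => u x * W x * G x) (volume.restrict (Ω : Set Plane)) := fun G => by
    have := integrable_mul_continuous hb (W * G).continuous u
    simpa [mul_assoc] using this
  have hspan : ∀ G ∈ symCosAlgebra b q a, ∫ x in (Ω : Set Plane), u x * W x * G x = 0 := by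
    intro G hG
    have hle : Submodule.span ℝ (Set.range fun p : ℤ × ℤ => symCos b q a p.1 p.2)
        ≤ LinearMap.ker (pairing hb u ∘ₗ LinearMap.mulLeft ℝ W) := by
      rw [Submodule.span_le]
      rintro _ ⟨⟨m, n⟩, rfl⟩
      exact h m n
    have := hle hG
    rw [LinearMap.mem_ker] at this
    simpa [pairing, mul_assoc] using this
  have huW : IntegrableOn (fun x => u x * W x) Ω := integrable_mul_continuous hb W.continuous u
  have key : ∀ᵐ x, x ∈ (Ω : Set Plane) → u x * W x = 0 := by
    refine Ω.isOpen.ae_eq_zero_of_integral_contDiff_smul_eq_zero huW.locallyIntegrableOn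
      fun g hg _ hsupp => ?_
    have hg0 : ∀ x, x ∉ (Ω : Set Plane) → g x • (u x * W x) = 0 := fun x hx => by
      rw [image_eq_zero_of_notMem_tsupport fun h => hx (hsupp h), zero_smul]
    rw [← setIntegral_eq_integral_of_forall_compl_eq_zero hg0]
    set M := ∫ x in (Ω : Set Plane), |u x * W x|
    have hbound : ∀ ε > 0, |∫ x in (Ω : Set Plane), g x • (u x * W x)| ≤ ε * M := by
      intro ε hε
      obtain ⟨G, hG, hGg⟩ := exists_symCosAlgebra_near (b := b) (q := q) ha hg.continuous hε
      have e : ∫ x in (Ω : Set Plane), g x • (u x * W x)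
          = ∫ x in (Ω : Set Plane), (u x * W x * g x - u x * W x * G x) := by
        have hgi : Integrable (fun x => u x * W x * g x) (volume.restrict (Ω : Set Plane)) :=
          hint ⟨g, hg.continuous⟩
        rw [integral_sub hgi (hint G), hspan G hG, sub_zero]
        exact integral_congr_ae (ae_of_all _ fun x => mul_comm _ _)
      rw [e, ← integral_const_mul, ← Real.norm_eq_abs]
      refine norm_integral_le_of_norm_le (huW.norm.const_mul ε) ?_
      refine (ae_restrict_iff' hΩm).2 (ae_of_all _ fun x hx => ?_)
      obtain ⟨h1, h2, h3⟩ := (hΩ x).1 hx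
      rw [← mul_sub, norm_mul, mul_comm, norm_sub_rev]
      exact mul_le_mul_of_nonneg_right (hGg x ⟨h1.le, h2.le, h3.le⟩).le (norm_nonneg _)
    have hlim : Tendsto (fun ε : ℝ => ε * M) (𝓝[>] 0) (𝓝 0) := by
      have : Tendsto (fun ε : ℝ => ε * M) (𝓝 0) (𝓝 (0 * M)) :=
        (continuous_id.mul continuous_const).tendsto 0
      rw [zero_mul] at this
      exact this.mono_left nhdsWithin_le_nhds
    refine abs_nonpos_iff.1 (ge_of_tendsto hlim ?_)
    filter_upwards [self_mem_nhdsWithin] with ε hε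
    exact hbound ε hε
  rw [Lp.eq_zero_iff_ae_eq_zero]
  refine (ae_restrict_iff' hΩm).2 ?_
  filter_upwards [key] with x hx hxΩ
  exact (mul_eq_zero.1 (hx hxΩ)).resolve_right (hW x hxΩ)

theorem eq_zero_of_forall_symCos (ha : 0 < a) (hΩ : IsCoordTriangle b q a Ω)
    (hb : Bornology.IsBounded (Ω : Set Plane)) {u : L2 Ω}
    (h : ∀ m n : ℕ, n ≤ m → pairing hb u (symCos b q a m n) = 0) : u = 0 := by
  refine eq_zero_of_pairing_symCos ha hΩ hb (W := 1) (by simp) fun m n => ?_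
  have hcomm : ∀ m n, symCos b q a m n = symCos b q a n m := fun m n => by
    ext x; simp only [symCos_apply]; ring
  have hneg : ∀ m n, symCos b q a (-m) n = symCos b q a m n := fun m n => by
    ext x; simp [symCos_apply]
  have hnat : ∀ m n : ℕ, pairing hb u (symCos b q a m n) = 0 := fun m n => by
    rcases le_total n m with h' | h'
    · exact h m n h'
    · rw [hcomm]; exact h n m h'
  have habs : ∀ m n, symCos b q a m n = symCos b q a m.natAbs n := fun m n => by
    rcases Int.natAbs_eq m with h | h
    · rw [← h]
    · conv_lhs => rw [h, hneg]
  rw [one_mul, habs, hcomm, habs]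
  exact hnat _ _

theorem skewSin_two_one_ne_zero (ha : 0 < a) (hΩ : IsCoordTriangle b q a Ω) {x : Plane}
    (hx : x ∈ Ω) : skewSin b q a 2 1 x ≠ 0 := by
  obtain ⟨h1, h2, h3⟩ := (hΩ x).1 hx
  have hk : 0 < Real.pi / a := by positivity
  have hpi : Real.pi / a * a = Real.pi := by field_simp
  have hX : Real.pi / a * coord b q 0 x < Real.pi := by
    calc _ < Real.pi / a * a := by gcongr
      _ = Real.pi := hpi
  have hYX : Real.pi / a * coord b q 1 x < Real.pi / a * coord b q 0 x := by gcongr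
  have hY : 0 < Real.pi / a * coord b q 1 x := by positivity
  have e : skewSin b q a 2 1 x = 2 * (Real.sin (Real.pi / a * coord b q 0 x)
      * Real.sin (Real.pi / a * coord b q 1 x) * (Real.cos (Real.pi / a * coord b q 0 x)
        - Real.cos (Real.pi / a * coord b q 1 x))) := by
    have e2 : ∀ s, Real.pi / a * 2 * s = 2 * (Real.pi / a * s) := fun s => by ring
    rw [skewSin_apply]
    push_cast
    rw [e2, e2, Real.sin_two_mul, Real.sin_two_mul, mul_one]
    ring
  rw [e]
  have s1 := Real.sin_pos_of_pos_of_lt_pi (hY.trans hYX) hX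
  have s2 := Real.sin_pos_of_pos_of_lt_pi hY (hYX.trans hX)
  have c := Real.strictAntiOn_cos ⟨hY.le, (hYX.trans hX).le⟩ ⟨(hY.trans hYX).le, hX.le⟩ hYX
  exact mul_ne_zero two_ne_zero (mul_ne_zero (mul_ne_zero s1.ne' s2.ne') (sub_neg.2 c).ne)

theorem eq_zero_of_forall_skewSin (ha : 0 < a) (hΩ : IsCoordTriangle b q a Ω)
    (hb : Bornology.IsBounded (Ω : Set Plane)) {u : L2 Ω}
    (h : ∀ m n : ℕ, 1 ≤ n → n < m → pairing hb u (skewSin b q a m n) = 0) : u = 0 := by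
  have hcomm : ∀ m n, skewSin b q a m n = -skewSin b q a n m := fun m n => by
    ext x; simp only [skewSin_apply, ContinuousMap.neg_apply]; ring
  have hneg : ∀ m n, skewSin b q a (-m) n = -skewSin b q a m n := fun m n => by
    ext x; simp [skewSin_apply]; ring
  have hzero : ∀ m, skewSin b q a m 0 = 0 := fun m => by
    ext x; simp [skewSin_apply]
  have hdiag : ∀ m, skewSin b q a m m = 0 := fun m => by
    ext x; simp [skewSin_apply]
  have hnat : ∀ m n : ℕ, pairing hb u (skewSin b q a m n) = 0 := fun m n => by
    rcases Nat.eq_zero_or_pos n with h0 | hn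
    · simp [h0, hzero]
    rcases Nat.eq_zero_or_pos m with h0 | hm
    · rw [hcomm]; simp [h0, hzero]
    rcases lt_trichotomy n m with h' | h' | h'
    · exact h m n hn h'
    · simp [h', hdiag]
    · rw [hcomm, map_neg, h n m hm h', neg_zero]
  have habs : ∀ m n, pairing hb u (skewSin b q a m n) = 0 ↔
      pairing hb u (skewSin b q a m.natAbs n) = 0 := fun m n => by
    rcases Int.natAbs_eq m with h | h
    · rw [← h]
    · conv_lhs => rw [h, hneg, map_neg, neg_eq_zero]
  have hall : ∀ m n : ℤ, pairing hb u (skewSin b q a m n) = 0 := fun m n => by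
    rw [habs, hcomm, map_neg, neg_eq_zero, habs]
    exact hnat _ _
  refine eq_zero_of_pairing_symCos ha hΩ hb (W := skewSin b q a 2 1)
    (fun x hx => skewSin_two_one_ne_zero ha hΩ hx) fun m n => ?_
  rw [skewSin_mul_symCos]
  simp only [map_smul, map_add, hall, add_zero, smul_zero]

end Coordinates

/-! ### The heat traces of the triangle as double sums -/

section Coordinates

variable {b : OrthonormalBasis (Fin 2) ℝ Plane} {q : Plane} {a : ℝ}

theorem sin_freq_mul (ha : 0 < a) (m : ℕ) : Real.sin (Real.pi / a * m * a) = 0 := by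
  rw [show Real.pi / a * m * a = m * Real.pi by field_simp]
  exact Real.sin_nat_mul_pi m

theorem finite_fiber_sq_add_sq {c : ℝ} (hc : 0 < c) {ι : Type*} {i : ι → ℕ × ℕ}
    (hi : Function.Injective i) (lam : ℝ) :
    Finite {j : ι // (c * ((i j).1 : ℝ)) ^ 2 + (c * ((i j).2 : ℝ)) ^ 2 = lam} := by
  obtain ⟨N, hN⟩ := exists_nat_ge (lam / c ^ 2)
  have hle : ∀ k l : ℕ, (c * (k : ℝ)) ^ 2 + (c * (l : ℝ)) ^ 2 = lam → k ≤ N := fun k l h => by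
    have h1 : (k : ℝ) ^ 2 ≤ lam / c ^ 2 := by
      rw [le_div_iff₀ (by positivity)]
      nlinarith [sq_nonneg (c * (l : ℝ))]
    have h2 : (k : ℝ) ≤ (k : ℝ) ^ 2 := by exact_mod_cast Nat.le_self_pow two_ne_zero k
    exact_mod_cast h2.trans (h1.trans hN)
  have : Finite (Set.Iic N ×ˢ Set.Iic N : Set (ℕ × ℕ)) :=
    ((Set.finite_Iic N).prod (Set.finite_Iic N)).to_subtype
  refine Finite.of_injective (β := (Set.Iic N ×ˢ Set.Iic N : Set (ℕ × ℕ)))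
    (fun j => ⟨i j.1, hle _ _ j.2, hle _ (i j.1).1 (by rw [add_comm]; exact j.2)⟩) fun j k h => ?_
  exact Subtype.ext (hi (congrArg Subtype.val h))

variable (b q a) in
/-- The Dirichlet eigenfunction with frequencies `mπ/a` and `nπ/a`. -/
def sinPair (hb : Bornology.IsBounded (Ω : Set Plane)) (m n : ℕ) : L2 Ω :=
  pairL2 b q hb (-1) (contDiff_sin_mul (Real.pi / a * m)) (contDiff_sin_mul (Real.pi / a * n))

variable (b q a) in
/-- The Neumann eigenfunction with frequencies `mπ/a` and `nπ/a`. -/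
def cosPair (hb : Bornology.IsBounded (Ω : Set Plane)) (m n : ℕ) : L2 Ω :=
  pairL2 b q hb 1 (contDiff_cos_mul (Real.pi / a * m)) (contDiff_cos_mul (Real.pi / a * n))

theorem inner_sinPair (hb : Bornology.IsBounded (Ω : Set Plane)) (m n : ℕ) (u : L2 Ω) :
    inner ℝ (sinPair b q a hb m n) u = pairing hb u (skewSin b q a m n) := by
  rw [sinPair, pairL2, inner_toL2]
  simp [pairing, skewSin]

theorem inner_cosPair (hb : Bornology.IsBounded (Ω : Set Plane)) (m n : ℕ) (u : L2 Ω) :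
    inner ℝ (cosPair b q a hb m n) u = pairing hb u (symCos b q a m n) := by
  rw [cosPair, pairL2, inner_toL2]
  simp [pairing, symCos]

theorem inner_sinPair_sinPair (ha : 0 < a) (hΩ : IsCoordTriangle b q a Ω)
    (hb : Bornology.IsBounded (Ω : Set Plane)) {m n k l : ℕ} (hn : 1 ≤ n) (hnm : n < m)
    (hlk : l < k) :
    inner ℝ (sinPair b q a hb m n) (sinPair b q a hb k l)
      = if m = k ∧ n = l then a ^ 2 / 4 else 0 := by
  rw [sinPair, sinPair, inner_pairL2 hΩ hb (by norm_num), integral_sin_mul_sin ha (by omega),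
    integral_sin_mul_sin ha hn, integral_sin_mul_sin ha (by omega), integral_sin_mul_sin ha hn]
  have h2 : m ≠ l ∨ n ≠ k := by omega
  by_cases h : m = k ∧ n = l
  · obtain ⟨rfl, rfl⟩ := h
    simp only [if_neg hnm.ne', if_true, and_self]
    ring
  · have h1 : m ≠ k ∨ n ≠ l := by omega
    rw [if_neg h]
    rcases h1 with h1 | h1 <;> rcases h2 with h2 | h2 <;> simp [h1, h2]

theorem inner_cosPair_cosPair_eq_zero (ha : 0 < a) (hΩ : IsCoordTriangle b q a Ω)
    (hb : Bornology.IsBounded (Ω : Set Plane)) {m n k l : ℕ} (hnm : n ≤ m)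
    (hlk : l ≤ k) (hne : ¬ (m = k ∧ n = l)) :
    inner ℝ (cosPair b q a hb m n) (cosPair b q a hb k l) = 0 := by
  rw [cosPair, cosPair, inner_pairL2 hΩ hb (by norm_num)]
  simp only [integral_cos_mul_cos ha]
  have h1 : m ≠ k ∨ n ≠ l := by omega
  have h2 : m ≠ l ∨ n ≠ k := by omega
  rcases h1 with h1 | h1 <;> rcases h2 with h2 | h2 <;> simp [h1, h2]

theorem cosPair_ne_zero (ha : 0 < a) (hΩ : IsCoordTriangle b q a Ω)
    (hb : Bornology.IsBounded (Ω : Set Plane)) (m n : ℕ) : cosPair b q a hb m n ≠ 0 := by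
  intro h0
  have h : inner ℝ (cosPair b q a hb m n) (cosPair b q a hb m n) = (0 : ℝ) := by
    rw [h0, inner_zero_left]
  rw [cosPair, inner_pairL2 hΩ hb (by norm_num)] at h
  simp only [integral_cos_mul_cos ha, if_true] at h
  have hp : ∀ k : ℕ, 0 < (if k = 0 then a else a / 2) := fun k => by split_ifs <;> positivity
  have h1 := mul_pos (hp m) (hp n)
  by_cases hmn : m = n
  · simp only [hmn, if_true] at h h1
    linarith
  · rw [if_neg hmn] at h
    linarith

theorem dirichletHeatTrace_eq_tsum (ha : 0 < a) (hΩ : IsCoordTriangle b q a Ω) (t : ℝ) :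
    dirichletHeatTrace Ω t = ∑' p : {p : ℕ × ℕ // p.2 < p.1},
      ENNReal.ofReal (Real.exp (-((Real.pi / a * ((p.1.1 + 1 : ℕ) : ℝ)) ^ 2
        + (Real.pi / a * ((p.1.2 + 1 : ℕ) : ℝ)) ^ 2) * t)) := by
  have hb := hΩ.isBounded
  refine heatTraceOf_eq_tsum (e := fun p : {p : ℕ × ℕ // p.2 < p.1} =>
      sinPair b q a hb (p.1.1 + 1) (p.1.2 + 1))
    (ν := fun p => (Real.pi / a * ((p.1.1 + 1 : ℕ) : ℝ)) ^ 2
      + (Real.pi / a * ((p.1.2 + 1 : ℕ) : ℝ)) ^ 2) ?_ ?_ ?_ ?_ ?_ ?_ t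
  · exact fun p => sinPair_mem_dirichletEigenspace hΩ hb (sin_freq_mul ha _) (sin_freq_mul ha _)
  · rintro ⟨⟨m, n⟩, hmn⟩ h0
    have h := inner_sinPair_sinPair ha hΩ hb (m := m + 1) (n := n + 1) (k := m + 1) (l := n + 1)
      (by omega) (by simpa using hmn) (by simpa using hmn)
    simp only at h0
    rw [h0, inner_zero_left, if_pos ⟨rfl, rfl⟩] at h
    have : 0 < a ^ 2 / 4 := by positivity
    linarith
  · rintro ⟨⟨m, n⟩, hmn⟩ ⟨⟨k, l⟩, hkl⟩ hne
    refine (inner_sinPair_sinPair ha hΩ hb (by simp) (by simpa using hmn) (by simpa using hkl)).trans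
      (if_neg fun h => hne ?_)
    simp only [add_left_inj] at h
    simp [h.1, h.2]
  · intro lam u hu p hp
    exact dirichletEigenspace_inner_eq_zero hu
      (sinPair_mem_dirichletEigenspace hΩ hb (sin_freq_mul ha _) (sin_freq_mul ha _)) hp
  · intro u hu
    refine eq_zero_of_forall_skewSin ha hΩ hb fun m n hn hnm => ?_
    obtain ⟨m, rfl⟩ : ∃ k, m = k + 1 := ⟨m - 1, by omega⟩
    obtain ⟨n, rfl⟩ : ∃ k, n = k + 1 := ⟨n - 1, by omega⟩
    rw [← inner_sinPair]
    exact hu ⟨(m, n), by simpa using hnm⟩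
  · refine finite_fiber_sq_add_sq (by positivity)
      (i := fun p : {p : ℕ × ℕ // p.2 < p.1} => (p.1.1 + 1, p.1.2 + 1)) fun p p' h => ?_
    simp only [Prod.mk.injEq, add_left_inj] at h
    exact Subtype.ext (Prod.ext h.1 h.2)

theorem neumannHeatTrace_eq_tsum (ha : 0 < a) (hΩ : IsCoordTriangle b q a Ω) (t : ℝ) :
    neumannHeatTrace Ω t = ∑' p : {p : ℕ × ℕ // p.2 ≤ p.1},
      ENNReal.ofReal (Real.exp (-((Real.pi / a * (p.1.1 : ℝ)) ^ 2
        + (Real.pi / a * (p.1.2 : ℝ)) ^ 2) * t)) := by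
  have hb := hΩ.isBounded
  refine heatTraceOf_eq_tsum (e := fun p : {p : ℕ × ℕ // p.2 ≤ p.1} =>
      cosPair b q a hb p.1.1 p.1.2)
    (ν := fun p => (Real.pi / a * (p.1.1 : ℝ)) ^ 2
      + (Real.pi / a * (p.1.2 : ℝ)) ^ 2) ?_ ?_ ?_ ?_ ?_ ?_ t
  · exact fun p => cosPair_mem_neumannEigenspace hΩ hb (sin_freq_mul ha _) (sin_freq_mul ha _)
  · exact fun p => cosPair_ne_zero ha hΩ hb _ _
  · rintro ⟨⟨m, n⟩, hmn⟩ ⟨⟨k, l⟩, hkl⟩ hne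
    refine inner_cosPair_cosPair_eq_zero ha hΩ hb hmn hkl fun h => hne ?_
    simp only at h
    simp [h.1, h.2]
  · intro lam u hu p hp
    exact neumannEigenspace_inner_eq_zero hu
      (cosPair_mem_neumannEigenspace hΩ hb (sin_freq_mul ha _) (sin_freq_mul ha _)) hp
  · intro u hu
    refine eq_zero_of_forall_symCos ha hΩ hb fun m n hnm => ?_
    rw [← inner_cosPair]
    exact hu ⟨(m, n), hnm⟩
  · exact finite_fiber_sq_add_sq (by positivity) Subtype.val_injective

theorem dirichletHeatTrace_eq (ha : 0 < a) (hΩ : IsCoordTriangle b q a Ω) {t : ℝ} (ht : 0 < t) :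
    dirichletHeatTrace Ω t ≠ ⊤ ∧ (dirichletHeatTrace Ω t).toReal
      = (1 + 2 * gaussSum ((Real.pi / a) ^ 2 * t)) ^ 2 / 8
        + (-1) * ((1 + 2 * gaussSum ((Real.pi / a) ^ 2 * t)) / 4)
        + (-1) * ((1 + 2 * gaussSum ((Real.pi / a) ^ 2 * (2 * t))) / 4) + 3 / 8 := by
  obtain ⟨x, hx0, hx, h⟩ := tsum_lt_gauss (c := (Real.pi / a) ^ 2 * t) (by positivity)
  have e : dirichletHeatTrace Ω t = ENNReal.ofReal x := by
    rw [dirichletHeatTrace_eq_tsum ha hΩ, ← h]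
    refine tsum_congr fun p => ?_
    rw [← ENNReal.ofReal_mul (Real.exp_pos _).le, ← Real.exp_add]
    congr 2
    push_cast
    ring
  rw [e]
  refine ⟨ENNReal.ofReal_ne_top, ?_⟩
  rw [ENNReal.toReal_ofReal hx0, mul_left_comm ((Real.pi / a) ^ 2)]
  linarith

theorem neumannHeatTrace_eq (ha : 0 < a) (hΩ : IsCoordTriangle b q a Ω) {t : ℝ} (ht : 0 < t) :
    neumannHeatTrace Ω t ≠ ⊤ ∧ (neumannHeatTrace Ω t).toReal
      = (1 + 2 * gaussSum ((Real.pi / a) ^ 2 * t)) ^ 2 / 8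
        + 1 * ((1 + 2 * gaussSum ((Real.pi / a) ^ 2 * t)) / 4)
        + 1 * ((1 + 2 * gaussSum ((Real.pi / a) ^ 2 * (2 * t))) / 4) + 3 / 8 := by
  obtain ⟨x, hx0, hx, h⟩ := tsum_le_gauss (c := (Real.pi / a) ^ 2 * t) (by positivity)
  have e : neumannHeatTrace Ω t = ENNReal.ofReal x := by
    rw [neumannHeatTrace_eq_tsum ha hΩ, ← h]
    refine tsum_congr fun p => ?_
    rw [← ENNReal.ofReal_mul (Real.exp_pos _).le, ← Real.exp_add]
    congr 2
    ring
  rw [e]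
  refine ⟨ENNReal.ofReal_ne_top, ?_⟩
  rw [ENNReal.toReal_ofReal hx0, mul_left_comm ((Real.pi / a) ^ 2)]
  linarith

/-! ### The right isosceles triangle in coordinates -/

theorem coord_combination {s t : ℝ} (hst : s + t = 1) (k : Fin 2) (x y : Plane) :
    coord b q k (s • x + t • y) = s * coord b q k x + t * coord b q k y := by
  simp only [coord, inner_sub_right, inner_add_right, real_inner_smul_right]
  linear_combination (inner ℝ (b k) q) * hst

theorem convex_closedTriangle : Convex ℝ (closedTriangle b q a) := by
  rintro x ⟨x1, x2, x3⟩ y ⟨y1, y2, y3⟩ s t hs ht hst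
  simp only [closedTriangle, Set.mem_ofPred_eq, coord_combination hst]
  refine ⟨by positivity, by gcongr, ?_⟩
  calc _ ≤ s * a + t * a := by gcongr
    _ = a := by rw [← add_mul, hst, one_mul]

theorem eq_add_coord (x : Plane) : x = q + coord b q 0 x • b 0 + coord b q 1 x • b 1 := by
  have h := b.sum_repr (x - q)
  simp only [Fin.sum_univ_two, b.repr_apply_apply] at h
  rw [add_assoc]
  simp only [coord]
  rw [h]
  abel

theorem coord_add_smul (s t : ℝ) (k : Fin 2) :
    coord b q k (q + s • b 0 + t • b 1) = if k = 0 then s else t := by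
  have h := orthonormal_iff_ite.1 b.orthonormal
  rw [coord, add_assoc, add_sub_cancel_left, inner_add_right, real_inner_smul_right,
    real_inner_smul_right, h, h]
  fin_cases k <;> simp

theorem convexHull_eq_closedTriangle (ha : 0 < a) :
    convexHull ℝ {q + a • b 0, q, q + a • b 0 + a • b 1} = closedTriangle b q a := by
  have hp0 := coord_add_smul (b := b) (q := q) a 0
  have hr0 := coord_add_smul (b := b) (q := q) a a
  have hq0 := coord_add_smul (b := b) (q := q) 0 0
  simp only [zero_smul, add_zero] at hp0 hq0
  refine Set.Subset.antisymm (convexHull_min ?_ convex_closedTriangle) fun x hx => ?_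
  · rintro x (rfl | rfl | rfl)
    · simp [closedTriangle, hp0, ha.le]
    · simp [closedTriangle, hq0, ha.le]
    · simp [closedTriangle, hr0, ha.le]
  · obtain ⟨h1, h2, h3⟩ := hx
    set X := coord b q 0 x
    set Y := coord b q 1 x
    have hx' : x = ∑ i, (![(X - Y) / a, (a - X) / a, Y / a] : Fin 3 → ℝ) i
        • (![q + a • b 0, q, q + a • b 0 + a • b 1] : Fin 3 → Plane) i := by
      rw [Fin.sum_univ_three]
      refine (eq_add_coord (b := b) (q := q) x).trans ?_
      simp only [Matrix.cons_val_zero, Matrix.cons_val_one, Matrix.cons_val]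
      have e1 : (X - Y) / a + (a - X) / a + Y / a = 1 := by field_simp; ring
      have e2 : (X - Y) / a * a + Y / a * a = X := by field_simp; ring
      have e3 : Y / a * a = Y := by field_simp
      calc q + X • b 0 + Y • b 1
          = ((X - Y) / a + (a - X) / a + Y / a) • q + ((X - Y) / a * a + Y / a * a) • b 0
            + (Y / a * a) • b 1 := by rw [e1, e2, e3, one_smul]
        _ = _ := by module
    rw [hx']
    refine (convex_convexHull ℝ _).sum_mem (fun i _ => ?_) ?_ fun i _ => subset_convexHull ℝ _ ?_
    · fin_cases i
      · exact div_nonneg (sub_nonneg.2 h2) ha.le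
      · exact div_nonneg (sub_nonneg.2 h3) ha.le
      · exact div_nonneg h1 ha.le
    · rw [Fin.sum_univ_three]
      simp only [Matrix.cons_val_zero, Matrix.cons_val_one, Matrix.cons_val]
      field_simp
      ring
    · fin_cases i <;> simp

theorem isCoordTriangle_openTriangle (ha : 0 < a) :
    IsCoordTriangle b q a (openTriangle (q + a • b 0) q (q + a • b 0 + a • b 1)) := by
  intro x
  change x ∈ interior (convexHull ℝ _) ↔ _
  rw [convexHull_eq_closedTriangle ha]
  have c0 := (contDiff_coord (b := b) (q := q) 0).continuous
  have c1 := (contDiff_coord (b := b) (q := q) 1).continuous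
  constructor
  · intro hx
    -- an interior point may be moved a little in every direction
    have hmove : ∀ s t : ℝ, ∃ ε : ℝ, 0 < ε ∧ x + ε • (s • b 0 + t • b 1) ∈ closedTriangle b q a := by
      intro s t
      have hc : Tendsto (fun ε : ℝ => x + ε • (s • b 0 + t • b 1)) (𝓝[>] 0) (𝓝 x) := by
        have : Tendsto (fun ε : ℝ => x + ε • (s • b 0 + t • b 1)) (𝓝 0)
            (𝓝 (x + (0 : ℝ) • (s • b 0 + t • b 1))) :=
          (Continuous.tendsto (by fun_prop) 0)
        rw [zero_smul, add_zero] at this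
        exact this.mono_left nhdsWithin_le_nhds
      obtain ⟨ε, h1, h2⟩ := ((hc.eventually (mem_interior_iff_mem_nhds.1 hx)).and
        self_mem_nhdsWithin).exists
      exact ⟨ε, h2, h1⟩
    have hcoord : ∀ ε s t : ℝ, ∀ k, coord b q k (x + ε • (s • b 0 + t • b 1))
        = coord b q k x + ε * if k = 0 then s else t := by
      intro ε s t k
      have h := coord_add_smul (b := b) (q := q) s t k
      rw [coord, add_assoc, add_sub_cancel_left] at h
      rw [coord, add_sub_right_comm, inner_add_right, real_inner_smul_right, h]
      rfl
    refine ⟨?_, ?_, ?_⟩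
    · obtain ⟨ε, hε, h, -, -⟩ := hmove 0 (-1)
      rw [hcoord] at h
      simp at h
      linarith
    · obtain ⟨ε, hε, -, h, -⟩ := hmove 0 1
      rw [hcoord, hcoord] at h
      simp at h
      linarith
    · obtain ⟨ε, hε, -, -, h⟩ := hmove 1 0
      rw [hcoord] at h
      simp at h
      linarith
  · intro hx
    have hopen : IsOpen {x | 0 < coord b q 1 x ∧ coord b q 1 x < coord b q 0 x
        ∧ coord b q 0 x < a} :=
      (isOpen_lt continuous_const c1).inter ((isOpen_lt c1 c0).inter
        (isOpen_lt c0 continuous_const))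
    have hsub : {x | 0 < coord b q 1 x ∧ coord b q 1 x < coord b q 0 x ∧ coord b q 0 x < a}
        ⊆ closedTriangle b q a := fun y hy => ⟨hy.1.le, hy.2.1.le, hy.2.2.le⟩
    exact interior_maximal hsub hopen hx

end Coordinates

/-- The frame with origin `q` and axes along `p - q` and `r - p`: the right angle at `p` becomes the corner
`(a, 0)`, and the hypotenuse lies on the diagonal. -/
theorem exists_frame {a : ℝ} (ha : 0 < a) {p q r : Plane} (hpq : dist p q = a)
    (hpr : dist p r = a) (hright : EuclideanGeometry.angle q p r = Real.pi / 2) :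
    ∃ b : OrthonormalBasis (Fin 2) ℝ Plane,
      IsCoordTriangle b q a (openTriangle p q r) := by
  have hperp : inner ℝ (q - p) (r - p) = 0 :=
    InnerProductGeometry.inner_eq_zero_iff_angle_eq_pi_div_two _ _ |>.2 hright
  have hn1 : ‖p - q‖ = a := by rw [← dist_eq_norm, hpq]
  have hn2 : ‖r - p‖ = a := by rw [← dist_eq_norm, dist_comm, hpr]
  have hperp' : inner ℝ (p - q) (r - p) = 0 := by
    rw [← neg_sub q p, inner_neg_left, hperp, neg_zero]
  let v : Fin 2 → Plane := ![a⁻¹ • (p - q), a⁻¹ • (r - p)]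
  have hv : Orthonormal ℝ v := by
    refine ⟨fun i => ?_, fun i j hij => ?_⟩
    · fin_cases i
      · simp [v, norm_smul, hn1, abs_of_pos ha, ha.ne']
      · simp [v, norm_smul, hn2, abs_of_pos ha, ha.ne']
    · fin_cases i <;> fin_cases j
      · exact absurd rfl hij
      · simp [v, real_inner_smul_left, real_inner_smul_right, hperp']
      · simp [v, real_inner_smul_left, real_inner_smul_right, real_inner_comm, hperp']
      · exact absurd rfl hij
  obtain ⟨b, hbv⟩ := Orthonormal.exists_orthonormalBasis_extension_of_card_eq (𝕜 := ℝ)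
    (by simp) (v := v) (s := Set.univ) (hv.comp _ Subtype.val_injective)
  have hp : p = q + a • b 0 := by
    rw [hbv 0 trivial]
    simp [v, ha.ne']
  have hr : r = q + a • b 0 + a • b 1 := by
    rw [← hp, hbv 1 trivial]
    simp [v, ha.ne']
  refine ⟨b, ?_⟩
  rw [hr, hp]
  exact isCoordTriangle_openTriangle ha

end DomainHeat

end

theorem mainTheorem3 (a : ℝ) (ha : 0 < a) (p q r : DomainHeat.Plane)
    (hpq : dist p q = a) (hpr : dist p r = a)
    (hright : EuclideanGeometry.angle q p r = Real.pi / 2) :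
    (∀ t : ℝ, 0 < t →
      DomainHeat.dirichletHeatTrace (DomainHeat.openTriangle p q r) t ≠ ⊤ ∧
      DomainHeat.neumannHeatTrace (DomainHeat.openTriangle p q r) t ≠ ⊤) ∧
    (fun t : ℝ =>
      (DomainHeat.dirichletHeatTrace (DomainHeat.openTriangle p q r) t).toReal -
        (a ^ 2 / (8 * Real.pi * t) - a * (2 + √2) / (8 * √(Real.pi * t)) + 3 / 8
          - a / (2 * √(2 * Real.pi * t)) * Real.exp (-a ^ 2 / (2 * t))
          + a ^ 2 / (2 * Real.pi * t) * Real.exp (-a ^ 2 / t)))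
      =Θ[𝓝[>] 0] (fun t : ℝ => t ^ (-(1 / 2) : ℝ) * Real.exp (-a ^ 2 / t)) ∧
    (fun t : ℝ =>
      (DomainHeat.neumannHeatTrace (DomainHeat.openTriangle p q r) t).toReal -
        (a ^ 2 / (8 * Real.pi * t) + a * (2 + √2) / (8 * √(Real.pi * t)) + 3 / 8
          + a / (2 * √(2 * Real.pi * t)) * Real.exp (-a ^ 2 / (2 * t))
          + a ^ 2 / (2 * Real.pi * t) * Real.exp (-a ^ 2 / t)))
      =Θ[𝓝[>] 0] (fun t : ℝ => t ^ (-(1 / 2) : ℝ) * Real.exp (-a ^ 2 / t)) := by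
  obtain ⟨b, hΩ⟩ := DomainHeat.exists_frame ha hpq hpr hright
  refine ⟨fun t ht => ⟨(DomainHeat.dirichletHeatTrace_eq ha hΩ ht).1,
    (DomainHeat.neumannHeatTrace_eq ha hΩ ht).1⟩, ?_, ?_⟩
  · refine DomainHeat.isTheta_of_eq_scaledRemainder ha (σ := -1) (by norm_num) fun t ht => ?_
    rw [(DomainHeat.dirichletHeatTrace_eq ha hΩ ht).2, ← DomainHeat.trace_sub_expansion ha ht (-1)]
    ring
  · refine DomainHeat.isTheta_of_eq_scaledRemainder ha (σ := 1) one_ne_zero fun t ht => ?_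
    rw [(DomainHeat.neumannHeatTrace_eq ha hΩ ht).2, ← DomainHeat.trace_sub_expansion ha ht 1]
    ring
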